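/- Let $d\ge 2$ be an integer, let $I\subseteq\mathbb{R}$ be a nonempty bounded open interval, and let $1\le q<d/(d-1)$. **Notation.** $C^d(\overline I,\mathbb{C})$ is the space of functions $g\in C^d(I,\mathbb C)$ all of whose derivatives of order $\le d$ extend continuously to $\overline I$, with norm $\|g\|_{C^d(\overline I)}=\max_{0\le k\le d}\sup_{x\in I}|g^{(k)}(x)|$. Let $\mathcal{A}_d(\mathbb{C})$ be the set of unordered $d$-tuples $[z]=[z_1,\dots,z_d]$ of complex numbers, with the metric $$\mathbf d([z],[w])=\min_{\sigma\in S_d}\frac1{\sqrt d}\Big(\sum_{i=1}^d|z_i-w_{\sigma(i)}|^2\Big)^{1/2}.$$ A measurable $f:I\to\mathcal{A}_d(\mathbb{C})$ is in $W^{1,q}(I,\mathcal{A}_d(\mathbb{C}))$ if there is $0\le\varphi\in L^q(I)$ such that, for every $T\in\mathcal{A}_d(\mathbb{C})$, $x\mapsto\mathbf d(f(x),T)$ is in $W^{1,q}(I)$ and its weak derivative is bounded in absolute value by $\varphi$ almost everywhere. For a primitive $d$-th root of unity $\theta$ and $a\in\mathbb C$ put $[a]_\theta:=[a,\theta a,\dots,\theta^{d-1}a]$;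 the set $\mathcal{A}_{\mathrm{rad},d}(\mathbb{C})=\{[a]_\theta:a\in\mathbb{C}\}$ does not depend on $\theta$, and $W^{1,q}(I,\mathcal{A}_{\mathrm{rad},d}(\mathbb{C}))$ consists of the $f\in W^{1,q}(I,\mathcal{A}_d(\mathbb{C}))$ with values in it. A curve $f:I\to\mathcal{A}_{\mathrm{rad},d}(\mathbb{C})$ with $f(x_0)=[a]_\theta$ is differentiable at $x_0\in I$, with derivative $L\in\mathbb{C}$ along the branch $a$, if $\mathbf d\big(f(x),[a+L(x-x_0)]_\theta\big)=o(|x-x_0|)$ as $x\to x_0$, and $\theta^iL=\theta^jL$ whenever $\theta^ia=\theta^ja$, $0\le i,j<d$. For curves $f,h:I\to\mathcal{A}_{\mathrm{rad},d}(\mathbb{C})$ let $\mathbf s_{\mathrm{rad},0}(f,h)(x)=\mathbf d(f(x),h(x))$ and, wherever $f$ and $h$ are differentiable, $$\mathbf s_{\mathrm{rad},1}(f,h)(x)=\max\big|L-\theta^{r}M\big|,\qquad r=\min\big\{r\in\{0,\dots,d-1\}:|a-\theta^rb|=\mathbf d(f(x),h(x))\big\},$$ where the maximum is over all primitive $d$-th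 roots of unity $\theta$ and all branches $a$ of $f$ and $b$ of $h$ at $x$ (that is, $f(x)=[a]_\theta$, $h(x)=[b]_\theta$), and $L$, $M$ are the derivatives of $f$, $h$ at $x$ along $a$, $b$; set $\mathbf s_{\mathrm{rad},1}(f,h)(x)=0$ elsewhere. Finally let $$\mathbf d^{1,q}_{\mathrm{rad},I}(f,h)=\|\mathbf s_{\mathrm{rad},0}(f,h)\|_{L^\infty(I)}+\|\mathbf s_{\mathrm{rad},1}(f,h)\|_{L^q(I)}.$$ **Theorem.** Let $g,g_n\in C^d(\overline I,\mathbb{C})$ ($n\in\mathbb{N}$) with $\|g-g_n\|_{C^d(\overline I)}\to0$ as $n\to\infty$. (1) Let $\Lambda,\Lambda_n:I\to\mathcal{A}_d(\mathbb{C})$ be the curves of unordered solutions (with multiplicity) of $Z^d=g$ and $Z^d=g_n$, respectively. Then $\Lambda$ and all $\Lambda_n$ belong to $W^{1,q}(I,\mathcal{A}_{\mathrm{rad},d}(\mathbb{C}))$, and $$\mathbf d^{1,q}_{\mathrm{rad},I}(\Lambda,\Lambda_n)\to0\quad\text{as } n\to\infty.$$ (2) Let $\lambda,\lambda_n:I\to\mathbb{C}$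 be continuous with $\lambda^d=g$ and $\lambda_n^d=g_n$ on $I$. Then $\lambda$ and all $\lambda_n$ are differentiable almost everywhere in $I$ and belong to $W^{1,q}(I)$, their pointwise derivatives being their weak derivatives, and $$\big\||\lambda'|-|\lambda_n'|\big\|_{L^q(I)}\to0,\qquad \|\lambda_n'\|_{L^q(I)}\to\|\lambda'\|_{L^q(I)}\quad\text{as } n\to\infty.$$ -/

import Mathlib

open Set Filter Topology MeasureTheory
open scoped ENNReal

noncomputable section

namespace RadicalCurves

/-! ### Function spaces on an interval -/

/-- `C^k` up to the boundary of the bounded open set `I`: `g` is `C^k` on `I`, and each derivative of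
order at most `k` has a continuous extension to the closure of `I`. -/
def MemCkClosure (k : ℕ) (I : Set ℝ) (g : ℝ → ℂ) : Prop :=
  ContDiffOn ℝ k g I ∧
    ∀ j ≤ k, ∃ G : ℝ → ℂ, ContinuousOn G (closure I) ∧ EqOn G (iteratedDerivWithin j g I) I

/-- The norm `max_{j ≤ k} sup_{x ∈ I} |g^{(j)}(x)|`. -/
def ckNorm (k : ℕ) (I : Set ℝ) (g : ℝ → ℂ) : ℝ≥0∞ :=
  ⨆ j ∈ Finset.range (k + 1), ⨆ x ∈ I, ‖iteratedDerivWithin j g I x‖ₑ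

/-- `v` is the weak (distributional) derivative of `u` on the open set `I`. -/
def HasWeakDerivOn {E : Type*} [NormedAddCommGroup E] [NormedSpace ℝ E]
    (I : Set ℝ) (u v : ℝ → E) : Prop :=
  LocallyIntegrableOn u I ∧ LocallyIntegrableOn v I ∧
    ∀ φ : ℝ → ℝ, ContDiff ℝ (⊤ : ℕ∞) φ → HasCompactSupport φ → tsupport φ ⊆ I →
      ∫ x in I, deriv φ x • u x = -∫ x in I, φ x • v x

/-! ### Unordered tuples of complex numbers

The space of unordered complex `d`-tuples is `Sym ℂ d`. -/

/-- The unordered tuple `[z_1, …, z_d]`. -/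
def tuple {d : ℕ} (z : Fin d → ℂ) : Sym ℂ d :=
  ⟨Finset.univ.val.map z, by simp⟩

/-- The normalized Euclidean distance `d^{-1/2} ‖z - w‖_2` of ordered tuples. -/
def delta {d : ℕ} (z w : Fin d → ℂ) : ℝ :=
  Real.sqrt (∑ i, ‖z i - w i‖ ^ 2) / Real.sqrt d

/-- The metric on unordered tuples: the minimum of `delta z w` over all orderings `z` of `a` and
`w` of `b`. By `symDist_tuple` below this is the minimum over the permutations of one of them. -/
def symDist {d : ℕ} (a b : Sym ℂ d) : ℝ :=
  sInf {t : ℝ | ∃ z w : Fin d → ℂ, tuple z = a ∧ tuple w = b ∧ t = delta z w}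

theorem tuple_eq_iff {d : ℕ} (z w : Fin d → ℂ) :
    tuple z = tuple w ↔ ∃ σ : Equiv.Perm (Fin d), z = w ∘ σ := by
  constructor
  · intro h
    have h1 : Finset.univ.val.map z = Finset.univ.val.map w := congrArg Subtype.val h
    have h2 : ∀ c : ℂ, Nonempty ({i // z i = c} ≃ {i // w i = c}) := by
      intro c
      have h3 := congrArg (Multiset.countP (fun x => x = c)) h1
      rw [Multiset.countP_map, Multiset.countP_map] at h3
      refine ⟨Fintype.equivOfCardEq ?_⟩
      rw [Fintype.card_subtype, Fintype.card_subtype]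
      exact h3
    refine ⟨Equiv.ofFiberEquiv (fun c => (h2 c).some), ?_⟩
    funext i
    exact (Equiv.ofFiberEquiv_map (fun c => (h2 c).some) i).symm
  · rintro ⟨σ, rfl⟩
    apply Subtype.ext
    change Finset.univ.val.map (w ∘ σ) = Finset.univ.val.map w
    rw [← Multiset.map_map, Multiset.map_univ_val_equiv]

theorem symDist_tuple {d : ℕ} (z w : Fin d → ℂ) :
    symDist (tuple z) (tuple w) = ⨅ σ : Equiv.Perm (Fin d), delta z (w ∘ σ) := by
  unfold symDist iInf
  congr 1
  ext t
  constructor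
  · rintro ⟨z', w', hz, hw, rfl⟩
    obtain ⟨σ, rfl⟩ := (tuple_eq_iff _ _).1 hz
    obtain ⟨τ, rfl⟩ := (tuple_eq_iff _ _).1 hw
    refine ⟨σ.symm.trans τ, ?_⟩
    have h : ∑ i, ‖z i - (w ∘ σ.symm.trans τ) i‖ ^ 2 = ∑ i, ‖(z ∘ σ) i - (w ∘ τ) i‖ ^ 2 := by
      rw [← Equiv.sum_comp σ]
      simp
    simp only [delta, h]
  · rintro ⟨σ, rfl⟩
    exact ⟨z, w ∘ σ, rfl, (tuple_eq_iff _ _).2 ⟨σ, rfl⟩, rfl⟩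

/-- `f` belongs to the Sobolev class `W^{1,q}` of curves of unordered tuples on `I`: there is a
nonnegative `φ ∈ L^q(I)` such that for every `T` the function `x ↦ symDist (f x) T` is in `W^{1,q}(I)`
and its weak derivative is bounded by `φ` almost everywhere. (The requirement that these distance
functions be measurable is the measurability of `f`.) -/
def MemSobolev {d : ℕ} (I : Set ℝ) (q : ℝ≥0∞) (f : ℝ → Sym ℂ d) : Prop :=
  ∃ φ : ℝ → ℝ, (∀ x, 0 ≤ φ x) ∧ MemLp φ q (volume.restrict I) ∧
    ∀ T : Sym ℂ d, MemLp (fun x => symDist (f x) T) q (volume.restrict I) ∧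
      ∃ h : ℝ → ℝ, MemLp h q (volume.restrict I) ∧
        HasWeakDerivOn I (fun x => symDist (f x) T) h ∧
        ∀ᵐ x ∂(volume.restrict I), |h x| ≤ φ x

/-- The curve of unordered tuples `f` is differentiable at `x₀`, with ordering `z` of its value at
`x₀` and corresponding derivatives `L`: the first-order approximation
`[z_1 + L_1 (x - x₀), …, z_d + L_d (x - x₀)]` has error `o(|x - x₀|)`, and `L_i = L_j` whenever
`z_i = z_j`. -/
def HasTupleDerivAt {d : ℕ} (f : ℝ → Sym ℂ d) (z L : Fin d → ℂ) (x₀ : ℝ) : Prop :=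
  f x₀ = tuple z ∧
    (fun x => symDist (f x) (tuple fun i => z i + L i * ((x - x₀ : ℝ) : ℂ)))
      =o[𝓝 x₀] (fun x => x - x₀) ∧
    ∀ i j, z i = z j → L i = L j

/-! ### Unordered tuples of radicals -/

/-- The unordered tuple `[a, θ a, θ² a, …, θ^{d-1} a]`. -/
def radTuple (d : ℕ) (θ a : ℂ) : Sym ℂ d :=
  tuple fun i : Fin d => θ ^ (i : ℕ) * a

/-- Curves of class `W^{1,q}` on `I` with values in the set of unordered tuples of radicals
`[a, θ a, …, θ^{d-1} a]`, `a ∈ ℂ`, where `θ` is a primitive `d`-th root of unity. -/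
def MemRadSobolev {d : ℕ} (I : Set ℝ) (q : ℝ≥0∞) (f : ℝ → Sym ℂ d) : Prop :=
  MemSobolev I q f ∧
    ∀ x ∈ I, ∃ θ a : ℂ, IsPrimitiveRoot θ d ∧ f x = radTuple d θ a

/-- `f x₀ = [a, θ a, …, θ^{d-1} a]`, and `f` is differentiable at `x₀` with differential
`[L, θ L, …, θ^{d-1} L]`, where `θ^i L` is the derivative that belongs to the branch `θ^i a`. -/
def HasRadDerivAt {d : ℕ} (f : ℝ → Sym ℂ d) (θ a L : ℂ) (x₀ : ℝ) : Prop :=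
  HasTupleDerivAt f (fun i : Fin d => θ ^ (i : ℕ) * a) (fun i : Fin d => θ ^ (i : ℕ) * L) x₀

/-- The smallest `r ∈ {0, …, d-1}` such that `|a - θ^r b|` equals the distance of the unordered
tuples `[a, θ a, …, θ^{d-1} a]` and `[b, θ b, …, θ^{d-1} b]`. -/
def radIndex (d : ℕ) (θ a b : ℂ) : ℕ :=
  sInf {r : ℕ | r < d ∧ ‖a - θ ^ r * b‖ = symDist (radTuple d θ a) (radTuple d θ b)}

/-- The zeroth-order term: the pointwise distance. -/
def sRad0 {d : ℕ} (f g : ℝ → Sym ℂ d) (x : ℝ) : ℝ :=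
  symDist (f x) (g x)

/-- The first-order term: the maximum of `|L - θ^r M|` over the primitive `d`-th roots of unity `θ`
and the branches `a` of `f` and `b` of `g` at `x`, with derivatives `L` and `M`, where
`r = radIndex d θ a b` is the first index that realizes the distance. It is `0` where `f` or `g` is
not differentiable. -/
def sRad1 {d : ℕ} (f g : ℝ → Sym ℂ d) (x : ℝ) : ℝ≥0∞ :=
  ⨆ (θ : ℂ) (a : ℂ) (L : ℂ) (b : ℂ) (M : ℂ) (_ : IsPrimitiveRoot θ d)
    (_ : HasRadDerivAt f θ a L x) (_ : HasRadDerivAt g θ b M x),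
    ‖L - θ ^ radIndex d θ a b * M‖ₑ

/-- The radical distance on `E`: the `L^∞(E)` norm of `sRad0` plus the `L^q(E)` norm of `sRad1`. -/
def radDist {d : ℕ} (q : ℝ≥0∞) (E : Set ℝ) (f g : ℝ → Sym ℂ d) : ℝ≥0∞ :=
  eLpNorm (sRad0 f g) ⊤ (volume.restrict E) + eLpNorm (sRad1 f g) q (volume.restrict E)

/-- `Λ` is, on `I`, the curve of unordered solutions of `Z^d = g`, listed with multiplicity. -/
def IsSolutionCurve {d : ℕ} (I : Set ℝ) (g : ℝ → ℂ) (Λ : ℝ → Sym ℂ d) : Prop :=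
  ∀ x ∈ I, (Λ x : Multiset ℂ) = (Polynomial.X ^ d - Polynomial.C (g x)).roots

/-- `u` is of class `W^{1,q}` on `I`, with the pointwise derivative, which exists almost everywhere,
as weak derivative. -/
def MemW1Classical (I : Set ℝ) (q : ℝ≥0∞) (u : ℝ → ℂ) : Prop :=
  (∀ᵐ x ∂(volume.restrict I), DifferentiableAt ℝ u x) ∧
    MemLp u q (volume.restrict I) ∧ MemLp (deriv u) q (volume.restrict I) ∧
    HasWeakDerivOn I u (deriv u)

end RadicalCurves

end

noncomputable section

namespace RadicalCurves

/-! ### Families of successive derivatives -/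

/-! A root `λ` of `λ^d = g` satisfies `|λ'| = |g'| |g|^{1/d - 1} / d` wherever `g ≠ 0`; this
quantity is `radSpeed / d`. Everything rests on an `L^q` bound for it that is uniform in `g` and
correctly scaled.

The bound (`lintegral_radSpeed_le`): for a real function on an interval of length `ℓ`, normalized by
`|g^{(d)}| ≤ 1`, `|g| ≤ (4ℓ)^d`, `|g'| ≤ (4ℓ)^{d-1}`, one of three things happens. Either `|g| ≥
ℓ^d` throughout and the speed is bounded; or some derivative of order between `1` and `d - 1` has no
zero, so `g` has boundedly many monotone pieces and `∫ |g'| |g|^{-s}` is computed by substitution;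
or all these derivatives have zeros, and then the normalization is inherited by the two halves. Each
terminal case costs a constant times the length of its interval, so bisection adds up. A truncation
near the zeros of `g` stops the recursion and is removed by Fatou's lemma. Real and imaginary parts
give the complex case, and scaling gives the factor `A^{q/d}` when `|g^{(d)}| ≤ A`.

Regularity: the integral of the speed bounds the increments of roots and of the distances of
solution tuples, across zeros too, since a root is `0` there (`incrementBound_root`,
`incrementBound_symDist`). Absolute continuity then gives weak derivatives.

Convergence: `radDiffMin` dominates the difference of matched derivatives of roots of `g` and `g_n`.
Off the zeros of `g` it tends to `0` pointwise, and the uniform bound with an exponent `p > q`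
upgrades this to `L^q` (`tendsto_lintegral_rpow_zero`). Almost every zero of `g` is flat: all
derivatives up to order `d` vanish there. Small intervals containing a flat point have small
`g^{(d)}`, hence small `g_n^{(d)}` for large `n`, so the factor `A^{q/d}` makes the speed of the
roots of `g_n` negligible on them (`tendsto_lintegral_flatSet`). Finally, `HasRadDerivAt.eq` shows
that the equation forces the derivative along each branch, so `sRad1` is bounded by `radDiffMin`. -/

/-- `D 0, …, D d` are successive derivatives on `J`. -/
def IsDerivFamily {E : Type*} [NormedAddCommGroup E] [NormedSpace ℝ E]
    (d : ℕ) (J : Set ℝ) (D : ℕ → ℝ → E) : Prop :=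
  ∀ k < d, ∀ x ∈ J, HasDerivAt (D k) (D (k + 1) x) x

theorem IsDerivFamily.mono {E : Type*} [NormedAddCommGroup E] [NormedSpace ℝ E]
    {d d' : ℕ} {J J' : Set ℝ} {D : ℕ → ℝ → E} (h : IsDerivFamily d J D) (hd : d' ≤ d)
    (hJ : J' ⊆ J) : IsDerivFamily d' J' D :=
  fun k hk x hx => h k (hk.trans_le hd) x (hJ hx)

/-- A function on an open interval whose derivative has no zero is injective. -/
theorem injOn_of_hasDerivAt_ne_zero {a b : ℝ} {u u' : ℝ → ℝ}
    (hu : ∀ x ∈ Ioo a b, HasDerivAt u (u' x) x) (h0 : ∀ x ∈ Ioo a b, u' x ≠ 0) :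
    InjOn u (Ioo a b) := by
  have key : ∀ x ∈ Ioo a b, ∀ y ∈ Ioo a b, x < y → u x ≠ u y := by
    intro x hx y hy hxy hE
    have hsub : Icc x y ⊆ Ioo a b := fun z hz => ⟨hx.1.trans_le hz.1, hz.2.trans_lt hy.2⟩
    obtain ⟨c, hc, hc'⟩ := exists_hasDerivAt_eq_zero hxy
      (fun z hz => (hu z (hsub hz)).continuousAt.continuousWithinAt) hE
      (fun z hz => hu z (hsub (Ioo_subset_Icc_self hz)))
    exact h0 c (hsub (Ioo_subset_Icc_self hc)) hc'
  intro x hx y hy hE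
  rcases lt_trichotomy x y with h | h | h
  · exact absurd hE (key x hx y hy h)
  · exact h
  · exact absurd hE.symm (key y hy x hx h)

theorem lintegral_Icc_abs_rpow_neg_le {s m : ℝ} (hs : s < 1) (hm : 0 ≤ m) :
    ∫⁻ y in Icc (-m) m, ENNReal.ofReal (|y| ^ (-s)) ≤
      ENNReal.ofReal (2 * m ^ (1 - s) / (1 - s)) := by
  have h1 : ∫⁻ y in Icc 0 m, ENNReal.ofReal (|y| ^ (-s)) =
      ENNReal.ofReal (m ^ (1 - s) / (1 - s)) := by
    have hint : IntervalIntegrable (fun y : ℝ => y ^ (-s)) volume 0 m :=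
      intervalIntegral.intervalIntegrable_rpow' (by linarith)
    have hi := integral_rpow (a := 0) (b := m) (r := -s) (Or.inl (by linarith))
    rw [Real.zero_rpow (by linarith), sub_zero, show -s + 1 = 1 - s by ring] at hi
    rw [← hi, intervalIntegral.integral_of_le hm, ofReal_integral_eq_lintegral_ofReal,
      setLIntegral_congr Ioc_ae_eq_Icc.symm]
    · refine setLIntegral_congr_fun measurableSet_Ioc fun y hy => ?_
      simp only [abs_of_pos hy.1]
    · exact (intervalIntegrable_iff_integrableOn_Ioc_of_le hm).1 hint
    · refine (ae_restrict_iff' measurableSet_Ioc).2 (ae_of_all _ fun y hy => ?_)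
      exact Real.rpow_nonneg hy.1.le _
  have h2 : ∫⁻ y in Icc (-m) 0, ENNReal.ofReal (|y| ^ (-s)) =
      ∫⁻ y in Icc 0 m, ENNReal.ofReal (|y| ^ (-s)) := by
    have := (Measure.measurePreserving_neg (volume : Measure ℝ)).setLIntegral_comp_preimage_emb
      (MeasurableEquiv.neg ℝ).measurableEmbedding
      (fun y => ENNReal.ofReal (|y| ^ (-s))) (Icc 0 m)
    simpa using this
  have h3 : Icc (-m) m ⊆ Icc (-m) 0 ∪ Icc 0 m := by
    intro y hy
    rcases le_total y 0 with h | h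
    · exact Or.inl ⟨hy.1, h⟩
    · exact Or.inr ⟨h, hy.2⟩
  calc _ ≤ ∫⁻ y in Icc (-m) 0 ∪ Icc 0 m, ENNReal.ofReal (|y| ^ (-s)) := lintegral_mono_set h3
    _ ≤ _ := lintegral_union_le _ _ _
    _ = ENNReal.ofReal (m ^ (1 - s) / (1 - s)) + ENNReal.ofReal (m ^ (1 - s) / (1 - s)) := by
        rw [h2, h1]
    _ = _ := by
        have : 0 ≤ m ^ (1 - s) / (1 - s) := by
          have := Real.rpow_nonneg hm (1 - s)
          have : 0 < 1 - s := by linarith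
          positivity
        rw [← ENNReal.ofReal_add this this]
        congr 1; ring

theorem setLIntegral_Ioo_le_add {a b c : ℝ} (F : ℝ → ℝ≥0∞) :
    ∫⁻ x in Ioo a b, F x ≤ (∫⁻ x in Ioo a c, F x) + ∫⁻ x in Ioo c b, F x := by
  have h : Ioo a b ⊆ Ioo a c ∪ ({c} ∪ Ioo c b) := by
    intro x hx
    rcases lt_trichotomy x c with h | h | h
    · exact Or.inl ⟨hx.1, h⟩
    · exact Or.inr (Or.inl h)
    · exact Or.inr (Or.inr ⟨h, hx.2⟩)
  refine (lintegral_mono_set h).trans ((lintegral_union_le _ _ _).trans ?_)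
  refine add_le_add le_rfl ?_
  refine (lintegral_union_le _ _ _).trans ?_
  simp

/-- If the derivative of order `k + 1` has no zero, the weighted total variation
`∫ |u'| |u|^{-s}` is controlled by the size of `u`. -/
theorem lintegral_abs_deriv_mul_rpow_neg_le {s m : ℝ} (hs : s < 1) (hm : 0 ≤ m)
    (D : ℕ → ℝ → ℝ) (k : ℕ) : ∀ a b : ℝ, IsDerivFamily (k + 1) (Ioo a b) D →
      (∀ x ∈ Ioo a b, D (k + 1) x ≠ 0) → (∀ x ∈ Ioo a b, |D 0 x| ≤ m) →
      ∫⁻ x in Ioo a b, ENNReal.ofReal (|D 1 x|) * ENNReal.ofReal (|D 0 x| ^ (-s)) ≤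
        2 ^ k * ENNReal.ofReal (2 * m ^ (1 - s) / (1 - s)) := by
  induction k with
  | zero =>
    intro a b hD h0 hb
    have hder : ∀ x ∈ Ioo a b, HasDerivAt (D 0) (D 1 x) x := fun x hx => hD 0 (by simp) x hx
    -- `D 0` is injective here, so substituting `y = D 0 x` turns the integral into one of
    -- `|y|^{-s}` over a subset of `[-m, m]`.
    have h := lintegral_image_eq_lintegral_abs_deriv_mul measurableSet_Ioo
      (fun x hx => (hder x hx).hasDerivWithinAt) (injOn_of_hasDerivAt_ne_zero hder h0)
      (fun y => ENNReal.ofReal (|y| ^ (-s)))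
    rw [← h, pow_zero, one_mul]
    refine (lintegral_mono_set ?_).trans (lintegral_Icc_abs_rpow_neg_le hs hm)
    rintro _ ⟨x, hx, rfl⟩
    exact abs_le.1 (hb x hx)
  | succ k ih =>
    intro a b hD h0 hb
    have hD' : IsDerivFamily (k + 1) (Ioo a b) D := hD.mono (by simp) subset_rfl
    by_cases hz : ∃ c ∈ Ioo a b, D (k + 1) c = 0
    · obtain ⟨c, hc, hc0⟩ := hz
      -- `D (k + 1)` is injective, so `c` is its only zero; cutting there doubles the number of
      -- pieces, which explains `2 ^ k`.
      have hinj := injOn_of_hasDerivAt_ne_zero (fun x hx => hD (k + 1) (by simp) x hx) h0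
      have hl : Ioo a c ⊆ Ioo a b := Ioo_subset_Ioo_right hc.2.le
      have hr : Ioo c b ⊆ Ioo a b := Ioo_subset_Ioo_left hc.1.le
      have h1 := ih a c (hD'.mono le_rfl hl)
        (fun x hx hx0 => hx.2.ne (hinj (hl hx) hc (hx0.trans hc0.symm)))
        (fun x hx => hb x (hl hx))
      have h2 := ih c b (hD'.mono le_rfl hr)
        (fun x hx hx0 => hx.1.ne' (hinj (hr hx) hc (hx0.trans hc0.symm)))
        (fun x hx => hb x (hr hx))
      refine (setLIntegral_Ioo_le_add (c := c) _).trans ((add_le_add h1 h2).trans (le_of_eq ?_))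
      rw [pow_succ]; ring
    · push Not at hz
      refine (ih a b hD' hz hb).trans ?_
      gcongr <;> norm_num

/-! ### The integral estimate for real functions -/

/-- `|y'| |y|^{1/d - 1}`: up to the factor `d`, the speed of the `d`-th roots of a function with
value `y` and derivative `y'`. It is `0` if `y = 0`. -/
def radSpeed {E : Type*} [NormedAddCommGroup E] (d : ℕ) (y y' : E) : ℝ :=
  ‖y'‖ * ‖y‖ ^ ((1 : ℝ) / d - 1)

theorem radSpeed_nonneg {E : Type*} [NormedAddCommGroup E] (d : ℕ) (y y' : E) :
    0 ≤ radSpeed d y y' := by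
  unfold radSpeed; positivity

theorem one_div_sub_one_neg {d : ℕ} (hd : 2 ≤ d) : (1 : ℝ) / d - 1 < 0 := by
  have : (2 : ℝ) ≤ d := by exact_mod_cast hd
  have h : (1 : ℝ) / d < 1 := by rw [div_lt_one (by linarith)]; linarith
  linarith

theorem radSpeed_zero_left {E : Type*} [NormedAddCommGroup E] {d : ℕ} (hd : 2 ≤ d) (y' : E) :
    radSpeed d 0 y' = 0 := by
  rw [radSpeed, norm_zero, Real.zero_rpow (one_div_sub_one_neg hd).ne, mul_zero]

/-- The exponents `q` with `1 ≤ q < d/(d-1)`, written without division. -/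
theorem mul_one_sub_one_div_lt_one {d : ℕ} {q : ℝ} (hd : 2 ≤ d) (hq : q < (d : ℝ) / ((d : ℝ) - 1)) :
    q * (1 - 1 / d) < 1 := by
  have h2 : (2 : ℝ) ≤ d := by exact_mod_cast hd
  rw [lt_div_iff₀ (by linarith)] at hq
  have : q * (1 - 1 / d) = q * (d - 1) / d := by field_simp
  rw [this, div_lt_one (by linarith)]
  exact hq

/-- The sum of the constants of the two terminal cases of the bisection: `D 0` bounded below, and an
intermediate derivative without zeros. -/
def radConst (d : ℕ) (q : ℝ) : ℝ := (4 ^ (d - 1)) ^ q + 4 * 2 ^ d / (1 - q * (1 - 1 / d))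

/-- Mean value bound in terms of the diameter of the interval. -/
theorem norm_sub_le_of_hasDerivAt {E : Type*} [NormedAddCommGroup E] [NormedSpace ℝ E]
    {a b c : ℝ} {u u' : ℝ → E} (hc : 0 ≤ c)
    (hu : ∀ x ∈ Ioo a b, HasDerivAt u (u' x) x) (hb : ∀ x ∈ Ioo a b, ‖u' x‖ ≤ c)
    {x y : ℝ} (hx : x ∈ Ioo a b) (hy : y ∈ Ioo a b) : ‖u x - u y‖ ≤ c * (b - a) := by
  have h := (convex_Ioo a b).norm_image_sub_le_of_norm_hasDerivWithin_le
    (fun z hz => (hu z hz).hasDerivWithinAt) hb hy hx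
  refine h.trans ?_
  gcongr
  rw [Real.norm_eq_abs, abs_le]
  constructor <;> linarith [hx.1, hx.2, hy.1, hy.2]

/-- If each of the derivatives of order `m, …, d - 1` has a zero, then those derivatives are
controlled by the derivative of order `d`. -/
theorem IsDerivFamily.norm_le_of_zeros {E : Type*} [NormedAddCommGroup E] [NormedSpace ℝ E]
    {d m : ℕ} {a b A : ℝ} (hab : a < b) (hA : 0 ≤ A) {D : ℕ → ℝ → E}
    (hD : IsDerivFamily d (Ioo a b) D) (hd : ∀ x ∈ Ioo a b, ‖D d x‖ ≤ A)
    (hz : ∀ k, m ≤ k → k < d → ∃ c ∈ Ioo a b, D k c = 0) {k : ℕ} (hmk : m ≤ k) (hkd : k ≤ d) :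
    ∀ x ∈ Ioo a b, ‖D k x‖ ≤ A * (b - a) ^ (d - k) := by
  induction hkd using Nat.decreasingInduction with
  | self => simpa using hd
  | of_succ k hk ih =>
    intro x hx
    have ih := ih (hmk.trans (Nat.le_succ k))
    obtain ⟨c, hc, hc0⟩ := hz k hmk hk
    have hl : 0 ≤ b - a := by linarith
    have h := norm_sub_le_of_hasDerivAt (by positivity) (hD k hk) ih hx hc
    rw [hc0, sub_zero] at h
    rwa [show d - k = d - (k + 1) + 1 by omega, pow_succ, ← mul_assoc]

/-- The exponents satisfy `(d - 1)(q - 1) + d (1 - q (1 - 1/d)) = 1`. This makes the estimate linear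
in the length of the interval, hence additive under subdivision. -/
theorem rpow_pow_mul_rpow_pow {d : ℕ} {q P : ℝ} (hd : 2 ≤ d) (hP : 0 < P) :
    (P ^ (d - 1)) ^ (q - 1) * (P ^ d) ^ (1 - q * (1 - 1 / d)) = P := by
  have h2 : (2 : ℝ) ≤ d := by exact_mod_cast hd
  rw [← Real.rpow_natCast, ← Real.rpow_natCast, ← Real.rpow_mul hP.le, ← Real.rpow_mul hP.le,
    ← Real.rpow_add hP, Nat.cast_sub (by omega)]
  nth_rw 2 [← Real.rpow_one P]
  congr 1
  push_cast
  field_simp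
  ring

theorem pow_rpow_one_div_sub_one {d : ℕ} {P : ℝ} (hd : 2 ≤ d) (hP : 0 < P) :
    (P ^ d) ^ ((1 : ℝ) / d - 1) * P ^ (d - 1) = 1 := by
  have h2 : (2 : ℝ) ≤ d := by exact_mod_cast hd
  rw [← Real.rpow_natCast, ← Real.rpow_natCast, ← Real.rpow_mul hP.le,
    ← Real.rpow_add hP, Nat.cast_sub (by omega)]
  convert Real.rpow_zero P
  push_cast
  field_simp
  ring

/-- First terminal case of the bisection. The powers of `b - a` in the bounds for `D 1` and for `D
0` cancel, so the speed is at most `4 ^ (d - 1)` pointwise. -/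
theorem lintegral_radSpeed_le_of_le {d : ℕ} {q : ℝ} (hd : 2 ≤ d) (hq1 : 1 ≤ q) {a b : ℝ}
    (hab : a < b) {D : ℕ → ℝ → ℝ}
    (h1 : ∀ x ∈ Ioo a b, |D 1 x| ≤ (4 * (b - a)) ^ (d - 1))
    (h0 : ∀ x ∈ Ioo a b, (b - a) ^ d ≤ |D 0 x|) :
    ∫⁻ x in Ioo a b, ENNReal.ofReal (radSpeed d (D 0 x) (D 1 x) ^ q) ≤
      ENNReal.ofReal ((4 ^ (d - 1)) ^ q * (b - a)) := by
  have hl : 0 < b - a := by linarith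
  have key : ∀ x ∈ Ioo a b, ENNReal.ofReal (radSpeed d (D 0 x) (D 1 x) ^ q) ≤
      ENNReal.ofReal ((4 ^ (d - 1)) ^ q) := by
    intro x hx
    refine ENNReal.ofReal_le_ofReal (Real.rpow_le_rpow (radSpeed_nonneg _ _ _) ?_ (by linarith))
    have e1 : |D 0 x| ^ ((1 : ℝ) / d - 1) ≤ ((b - a) ^ d) ^ ((1 : ℝ) / d - 1) :=
      Real.rpow_le_rpow_of_nonpos (by positivity) (h0 x hx) (one_div_sub_one_neg hd).le
    calc radSpeed d (D 0 x) (D 1 x)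
        ≤ (4 * (b - a)) ^ (d - 1) * ((b - a) ^ d) ^ ((1 : ℝ) / d - 1) := by
          unfold radSpeed
          exact mul_le_mul (h1 x hx) e1 (by positivity) (by positivity)
      _ = 4 ^ (d - 1) * (((b - a) ^ d) ^ ((1 : ℝ) / d - 1) * (b - a) ^ (d - 1)) := by
          rw [mul_pow]; ring
      _ = 4 ^ (d - 1) := by rw [pow_rpow_one_div_sub_one hd hl, mul_one]
  refine (setLIntegral_mono' measurableSet_Ioo key).trans (le_of_eq ?_)
  rw [setLIntegral_const, Real.volume_Ioo, ← ENNReal.ofReal_mul (by positivity)]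

/-- Second terminal case. In `|D 1|^q = |D 1|^{q-1} |D 1|` the first factor is bounded by `h1`; what
is left is the weighted total variation with exponent `s = q (1 - 1/d) < 1`. -/
theorem lintegral_radSpeed_le_of_ne_zero {d : ℕ} {q : ℝ} (hd : 2 ≤ d) (hq1 : 1 ≤ q)
    (hq : q * (1 - 1 / d) < 1) {a b : ℝ} (hab : a < b) {D : ℕ → ℝ → ℝ}
    (hD : IsDerivFamily d (Ioo a b) D)
    (h0 : ∀ x ∈ Ioo a b, |D 0 x| ≤ (4 * (b - a)) ^ d)
    (h1 : ∀ x ∈ Ioo a b, |D 1 x| ≤ (4 * (b - a)) ^ (d - 1))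
    {k : ℕ} (hk : k + 1 < d) (hne : ∀ x ∈ Ioo a b, D (k + 1) x ≠ 0) :
    ∫⁻ x in Ioo a b, ENNReal.ofReal (radSpeed d (D 0 x) (D 1 x) ^ q) ≤
      ENNReal.ofReal (4 * 2 ^ d / (1 - q * (1 - 1 / d)) * (b - a)) := by
  have hl : 0 < b - a := by linarith
  have hs : 0 < 1 - q * (1 - 1 / d) := by linarith
  set s : ℝ := q * (1 - 1 / d) with hsdef
  have key : ∀ x ∈ Ioo a b, ENNReal.ofReal (radSpeed d (D 0 x) (D 1 x) ^ q) ≤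
      ENNReal.ofReal (((4 * (b - a)) ^ (d - 1)) ^ (q - 1)) *
        (ENNReal.ofReal (|D 1 x|) * ENNReal.ofReal (|D 0 x| ^ (-s))) := by
    intro x hx
    rw [← ENNReal.ofReal_mul (by positivity), ← ENNReal.ofReal_mul (by positivity)]
    refine ENNReal.ofReal_le_ofReal ?_
    rw [radSpeed, Real.norm_eq_abs, Real.norm_eq_abs, Real.mul_rpow (by positivity) (by positivity),
      ← Real.rpow_mul (abs_nonneg _), show ((1 : ℝ) / d - 1) * q = -s by rw [hsdef]; ring,
      ← mul_assoc]
    gcongr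
    rcases (abs_nonneg (D 1 x)).eq_or_lt with h | h
    · rw [← h, Real.zero_rpow (by linarith), mul_zero]
    · calc |D 1 x| ^ q = |D 1 x| ^ (q - 1) * |D 1 x| := by
            rw [← Real.rpow_add_one h.ne']; congr 1; ring
        _ ≤ _ := by
            refine mul_le_mul_of_nonneg_right ?_ (abs_nonneg _)
            exact Real.rpow_le_rpow (abs_nonneg _) (h1 x hx) (by linarith)
  refine (setLIntegral_mono' measurableSet_Ioo key).trans ?_
  rw [lintegral_const_mul' _ _ ENNReal.ofReal_ne_top]
  have h := lintegral_abs_deriv_mul_rpow_neg_le (s := s) (by linarith)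
    (m := (4 * (b - a)) ^ d) (by positivity) D k a b (hD.mono (by omega) subset_rfl) hne h0
  refine (mul_le_mul_right h _).trans ?_
  rw [show (2 : ℝ≥0∞) = ENNReal.ofReal 2 by simp, ← ENNReal.ofReal_pow (by norm_num),
    ← ENNReal.ofReal_mul (by positivity), ← ENNReal.ofReal_mul (by positivity)]
  refine ENNReal.ofReal_le_ofReal ?_
  have hP := rpow_pow_mul_rpow_pow (q := q) hd (show 0 < 4 * (b - a) by positivity)
  rw [← hsdef] at hP
  calc ((4 * (b - a)) ^ (d - 1)) ^ (q - 1) *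
        (2 ^ k * (2 * ((4 * (b - a)) ^ d) ^ (1 - s) / (1 - s)))
      = 2 ^ (k + 1) / (1 - s) *
        (((4 * (b - a)) ^ (d - 1)) ^ (q - 1) * ((4 * (b - a)) ^ d) ^ (1 - s)) := by
        rw [pow_succ]; ring
    _ = 2 ^ (k + 1) / (1 - s) * (4 * (b - a)) := by rw [hP]
    _ ≤ 2 ^ d / (1 - s) * (4 * (b - a)) := by
        gcongr
        norm_num
    _ = _ := by ring

/-- Bisection with at most `n` generations. After `n` halvings the normalization bounds `|D 0|` by
exactly the truncation threshold, so the remaining integrand is zero. The bound does not depend on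
`n`. -/
theorem lintegral_radSpeed_inter_le {d : ℕ} {q : ℝ} (hd : 2 ≤ d) (hq1 : 1 ≤ q)
    (hq : q * (1 - 1 / d) < 1) (n : ℕ) : ∀ (a b : ℝ), a < b → ∀ D : ℕ → ℝ → ℝ,
    IsDerivFamily d (Ioo a b) D → (∀ x ∈ Ioo a b, |D d x| ≤ 1) →
    (∀ x ∈ Ioo a b, |D 0 x| ≤ (4 * (b - a)) ^ d) →
    (∀ x ∈ Ioo a b, |D 1 x| ≤ (4 * (b - a)) ^ (d - 1)) →
    ∫⁻ x in Ioo a b, {x | (4 * (b - a) / 2 ^ n) ^ d < |D 0 x|}.indicator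
      (fun x => ENNReal.ofReal (radSpeed d (D 0 x) (D 1 x) ^ q)) x ≤
        ENNReal.ofReal (radConst d q * (b - a)) := by
  have hs : 0 < 1 - q * (1 - 1 / d) := by linarith
  induction n with
  | zero =>
    intro a b hab D hD hd1 h0 h1
    rw [setLIntegral_congr_fun (g := fun _ => 0) measurableSet_Ioo]
    · simp
    · intro x hx
      refine indicator_of_notMem ?_ _
      simpa using h0 x hx
  | succ n ih =>
    intro a b hab D hD hd1 h0 h1
    have hl : 0 < b - a := by linarith
    have hind : ∀ x, {x | (4 * (b - a) / 2 ^ (n + 1)) ^ d < |D 0 x|}.indicator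
      (fun x => ENNReal.ofReal (radSpeed d (D 0 x) (D 1 x) ^ q)) x ≤
        ENNReal.ofReal (radSpeed d (D 0 x) (D 1 x) ^ q) := fun x => indicator_le_self _ _ x
    by_cases c0 : ∀ x ∈ Ioo a b, (b - a) ^ d ≤ |D 0 x|
    · refine (lintegral_mono hind).trans ((lintegral_radSpeed_le_of_le hd hq1 hab h1 c0).trans ?_)
      refine ENNReal.ofReal_le_ofReal (mul_le_mul_of_nonneg_right ?_ hl.le)
      rw [radConst, le_add_iff_nonneg_right]
      positivity
    by_cases c1 : ∃ k, k + 1 < d ∧ ∀ x ∈ Ioo a b, D (k + 1) x ≠ 0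
    · obtain ⟨k, hk, hne⟩ := c1
      refine (lintegral_mono hind).trans
        ((lintegral_radSpeed_le_of_ne_zero hd hq1 hq hab hD h0 h1 hk hne).trans ?_)
      refine ENNReal.ofReal_le_ofReal (mul_le_mul_of_nonneg_right ?_ hl.le)
      rw [radConst, le_add_iff_nonneg_left]
      positivity
    push Not at c0 c1
    -- Neither terminal case holds: every derivative of order `1, …, d - 1` has a zero, and `|D 0|`
    -- is below `(b - a) ^ d` at `y`. Repeated mean value bounds now control `D 1` and `D 0` on the
    -- whole interval.
    obtain ⟨y, hy, hy0⟩ := c0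
    have hD1 : ∀ x ∈ Ioo a b, |D 1 x| ≤ (b - a) ^ (d - 1) := by
      have := hD.norm_le_of_zeros hab zero_le_one hd1 (m := 1) (k := 1)
        (fun k hk hkd => by
          obtain ⟨j, rfl⟩ : ∃ j, k = j + 1 := ⟨k - 1, by omega⟩
          exact c1 j hkd) le_rfl (by omega)
      simpa using this
    have hD0 : ∀ x ∈ Ioo a b, |D 0 x| ≤ 2 * (b - a) ^ d := by
      intro x hx
      have h := norm_sub_le_of_hasDerivAt (by positivity) (hD 0 (by omega)) hD1 hx hy
      rw [← pow_succ, show d - 1 + 1 = d by omega, Real.norm_eq_abs] at h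
      have := abs_sub_abs_le_abs_sub (D 0 x) (D 0 y)
      linarith
    -- Here the constant `4` of the normalization is used: `2 ℓ^d ≤ (2ℓ)^d = (4 (ℓ/2))^d`, which is
    -- the hypothesis for an interval of half the length.
    have hb0 : ∀ x ∈ Ioo a b, |D 0 x| ≤ (4 * ((b - a) / 2)) ^ d := by
      intro x hx
      refine (hD0 x hx).trans ?_
      rw [show 4 * ((b - a) / 2) = 2 * (b - a) by ring, mul_pow]
      gcongr
      calc (2 : ℝ) = 2 ^ 1 := by norm_num
        _ ≤ 2 ^ d := pow_le_pow_right₀ (by norm_num) (by omega)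
    have hb1 : ∀ x ∈ Ioo a b, |D 1 x| ≤ (4 * ((b - a) / 2)) ^ (d - 1) := by
      intro x hx
      refine (hD1 x hx).trans ?_
      gcongr
      linarith
    set c := (a + b) / 2 with hc
    have e1 : c - a = (b - a) / 2 := by rw [hc]; ring
    have e2 : b - c = (b - a) / 2 := by rw [hc]; ring
    have hac : Ioo a c ⊆ Ioo a b := Ioo_subset_Ioo_right (by linarith)
    have hcb : Ioo c b ⊆ Ioo a b := Ioo_subset_Ioo_left (by linarith)
    have i1 := ih a c (by linarith) D (hD.mono le_rfl hac) (fun x hx => hd1 x (hac hx))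
      (fun x hx => by rw [e1]; exact hb0 x (hac hx)) (fun x hx => by rw [e1]; exact hb1 x (hac hx))
    have i2 := ih c b (by linarith) D (hD.mono le_rfl hcb) (fun x hx => hd1 x (hcb hx))
      (fun x hx => by rw [e2]; exact hb0 x (hcb hx)) (fun x hx => by rw [e2]; exact hb1 x (hcb hx))
    have e3 : 4 * ((b - a) / 2) / 2 ^ n = 4 * (b - a) / 2 ^ (n + 1) := by
      rw [pow_succ]; field_simp
    rw [e1, e3] at i1
    rw [e2, e3] at i2
    refine (setLIntegral_Ioo_le_add (c := c) _).trans ((add_le_add i1 i2).trans (le_of_eq ?_))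
    have hC : 0 ≤ radConst d q * ((b - a) / 2) := by
      unfold radConst; positivity
    rw [← ENNReal.ofReal_add hC hC]
    congr 1; ring

theorem radConst_nonneg {d : ℕ} {q : ℝ} (hq : q * (1 - 1 / d) < 1) : 0 ≤ radConst d q := by
  have hs : 0 < 1 - q * (1 - 1 / d) := by linarith
  unfold radConst; positivity

theorem lintegral_radSpeed_le_real {d : ℕ} {q : ℝ} (hd : 2 ≤ d) (hq1 : 1 ≤ q)
    (hq : q * (1 - 1 / d) < 1) {a b : ℝ} (hab : a < b) {D : ℕ → ℝ → ℝ}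
    (hD : IsDerivFamily d (Ioo a b) D) (hd1 : ∀ x ∈ Ioo a b, |D d x| ≤ 1)
    (h0 : ∀ x ∈ Ioo a b, |D 0 x| ≤ (4 * (b - a)) ^ d)
    (h1 : ∀ x ∈ Ioo a b, |D 1 x| ≤ (4 * (b - a)) ^ (d - 1)) :
    ∫⁻ x in Ioo a b, ENNReal.ofReal (radSpeed d (D 0 x) (D 1 x) ^ q) ≤
      ENNReal.ofReal (radConst d q * (b - a)) := by
  have hl : 0 < b - a := by linarith
  have hc0 : ContinuousOn (D 0) (Ioo a b) := fun x hx =>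
    (hD 0 (by omega) x hx).continuousAt.continuousWithinAt
  have hc1 : ContinuousOn (D 1) (Ioo a b) := fun x hx =>
    (hD 1 (by omega) x hx).continuousAt.continuousWithinAt
  have hm0 := hc0.aemeasurable (μ := volume) measurableSet_Ioo
  have hm1 := hc1.aemeasurable (μ := volume) measurableSet_Ioo
  have hF : AEMeasurable (fun x => ENNReal.ofReal (radSpeed d (D 0 x) (D 1 x) ^ q))
      (volume.restrict (Ioo a b)) := by
    unfold radSpeed
    exact ((hm1.norm.mul (hm0.norm.pow_const _)).pow_const _).ennreal_ofReal
  have hlim : Tendsto (fun n : ℕ => (4 * (b - a) / 2 ^ n) ^ d) atTop (𝓝 0) := by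
    have h : Tendsto (fun n : ℕ => 4 * (b - a) * (1 / 2) ^ n) atTop (𝓝 (4 * (b - a) * 0)) :=
      (tendsto_pow_atTop_nhds_zero_of_lt_one (by norm_num) (by norm_num)).const_mul _
    have h' := h.pow d
    rw [mul_zero, zero_pow (by omega)] at h'
    refine h'.congr fun n => ?_
    rw [one_div, inv_pow, div_eq_mul_inv]
  have hmeas : ∀ n : ℕ, AEMeasurable ({x | (4 * (b - a) / 2 ^ n) ^ d < |D 0 x|}.indicator
      (fun x => ENNReal.ofReal (radSpeed d (D 0 x) (D 1 x) ^ q))) (volume.restrict (Ioo a b)) := by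
    intro n
    refine hF.indicator₀ ?_
    exact nullMeasurableSet_lt aemeasurable_const hm0.norm
  calc _ ≤ ∫⁻ x in Ioo a b, liminf (fun n : ℕ => {x | (4 * (b - a) / 2 ^ n) ^ d < |D 0 x|}.indicator
      (fun x => ENNReal.ofReal (radSpeed d (D 0 x) (D 1 x) ^ q)) x) atTop := by
        refine lintegral_mono fun x => ?_
        -- At a zero of `D 0` the integrand is `0` because `radSpeed` is; elsewhere the threshold
        -- eventually falls below `|D 0 x|` and the indicator is inactive.
        rcases (abs_nonneg (D 0 x)).eq_or_lt with h | h
        · have : D 0 x = 0 := abs_eq_zero.1 h.symm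
          simp only [this]
          rw [radSpeed_zero_left hd, Real.zero_rpow (by linarith), ENNReal.ofReal_zero]
          exact zero_le
        · refine le_of_eq (Tendsto.liminf_eq ?_).symm
          refine tendsto_const_nhds.congr' ?_
          filter_upwards [hlim.eventually_lt_const h] with n hn
          rw [indicator_of_mem]
          exact hn
    _ ≤ _ := lintegral_liminf_le' hmeas
    _ ≤ _ := by
        refine liminf_le_of_le (by isBoundedDefault) fun c hc => ?_
        obtain ⟨n, hn⟩ := hc.exists
        exact hn.trans (lintegral_radSpeed_inter_le hd hq1 hq n a b hab D hD hd1 h0 h1)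

/-! ### Zeros and flat points -/

/-- A zero with nonzero derivative is isolated from the right in the zero set, and only countably
many points of a set of reals can be so. -/
theorem ae_deriv_eq_zero_of_eq_zero {E : Type*} [NormedAddCommGroup E] [NormedSpace ℝ E]
    {J : Set ℝ} {u u' : ℝ → E} (hu : ∀ x ∈ J, HasDerivAt u (u' x) x) :
    ∀ᵐ x, x ∈ J → u x = 0 → u' x = 0 := by
  have hc := (countable_setOfPred_isolated_right_within (s := {x | x ∈ J ∧ u x = 0})).ae_notMem
    (volume : Measure ℝ)
  filter_upwards [hc] with x hx hxJ hx0
  by_contra hne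
  refine hx ⟨⟨hxJ, hx0⟩, ?_⟩
  have h := ((hu x hxJ).eventually_ne (c := 0) hne).filter_mono
    (nhdsWithin_mono x (fun y (hy : y ∈ Ioi x) => ne_of_gt hy))
  have h' : ∀ᶠ z in 𝓝[{x | x ∈ J ∧ u x = 0} ∩ Ioi x] x, False := by
    filter_upwards [h.filter_mono (nhdsWithin_mono x inter_subset_right),
      self_mem_nhdsWithin] with z hz hz' using hz hz'.1.2
  simpa using h'

/-- Apply the preceding lemma to `D 0`, `D 1`, …, `D (d - 1)` in turn. -/
theorem IsDerivFamily.ae_flat {E : Type*} [NormedAddCommGroup E] [NormedSpace ℝ E]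
    {d : ℕ} {J : Set ℝ} {D : ℕ → ℝ → E} (hD : IsDerivFamily d J D) :
    ∀ᵐ x, x ∈ J → D 0 x = 0 → ∀ k ≤ d, D k x = 0 := by
  have h : ∀ k, ∀ᵐ x, k < d → x ∈ J → D k x = 0 → D (k + 1) x = 0 := by
    intro k
    by_cases hk : k < d
    · filter_upwards [ae_deriv_eq_zero_of_eq_zero (hD k hk)] with x hx _ using hx
    · exact ae_of_all _ fun x hk' => absurd hk' hk
  filter_upwards [ae_all_iff.2 h] with x hx hxJ h0 k
  induction k with
  | zero => exact fun _ => h0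
  | succ k ih => exact fun hk => hx k hk hxJ (ih (Nat.le_of_succ_le hk))

/-! ### The integral estimate for complex functions -/

theorem radSpeed_smul {E : Type*} [NormedAddCommGroup E] [NormedSpace ℝ E] {d : ℕ} {c : ℝ}
    (hc : 0 < c) (y y' : E) :
    radSpeed d (c • y) (c • y') = c ^ ((1 : ℝ) / d) * radSpeed d y y' := by
  unfold radSpeed
  rw [norm_smul, norm_smul, Real.norm_of_nonneg hc.le, Real.mul_rpow hc.le (norm_nonneg _)]
  have : c ^ ((1 : ℝ) / d) = c * c ^ ((1 : ℝ) / d - 1) := by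
    rw [Real.rpow_sub_one hc.ne']; field_simp
  rw [this]; ring

/-- The exponent `1/d - 1` is negative, so replacing `‖y‖` by the smaller `|y.re|` or `|y.im|`
increases the power. The hypotheses cover the case where such a part is `0` and its power is `0` by
convention; for a derivative family they hold almost everywhere. -/
theorem radSpeed_complex_le {d : ℕ} (hd : 2 ≤ d) {y y' : ℂ} (hre : y.re = 0 → y'.re = 0)
    (him : y.im = 0 → y'.im = 0) :
    radSpeed d y y' ≤ radSpeed d y.re y'.re + radSpeed d y.im y'.im := by
  have key : ∀ t t' : ℝ, (t = 0 → t' = 0) → |t| ≤ ‖y‖ →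
      |t'| * ‖y‖ ^ ((1 : ℝ) / d - 1) ≤ |t'| * |t| ^ ((1 : ℝ) / d - 1) := by
    intro t t' h h'
    by_cases ht : t = 0
    · simp [h ht]
    · gcongr ?_ * ?_
      exact Real.rpow_le_rpow_of_nonpos (abs_pos.2 ht) h' (one_div_sub_one_neg hd).le
  have h1 := key _ _ hre (Complex.abs_re_le_norm y)
  have h2 := key _ _ him (Complex.abs_im_le_norm y)
  unfold radSpeed
  simp only [Real.norm_eq_abs]
  refine le_trans ?_ (add_le_add h1 h2)
  rw [← add_mul]
  gcongr
  exact Complex.norm_le_abs_re_add_abs_im y'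

theorem add_rpow_le_two_rpow_mul {x y q : ℝ} (hx : 0 ≤ x) (hy : 0 ≤ y) (hq : 0 ≤ q) :
    (x + y) ^ q ≤ 2 ^ q * (x ^ q + y ^ q) := by
  have h1 : (x + y) ^ q ≤ (2 * max x y) ^ q := by
    gcongr
    linarith [le_max_left x y, le_max_right x y]
  rw [Real.mul_rpow (by norm_num) (le_max_of_le_left hx)] at h1
  refine h1.trans ?_
  gcongr
  have := Real.rpow_nonneg hx q
  have := Real.rpow_nonneg hy q
  rcases max_choice x y with h | h <;> rw [h] <;> linarith

theorem IsDerivFamily.clm_comp {E F : Type*} [NormedAddCommGroup E] [NormedSpace ℝ E]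
    [NormedAddCommGroup F] [NormedSpace ℝ F] {d : ℕ} {J : Set ℝ} {D : ℕ → ℝ → E}
    (hD : IsDerivFamily d J D) (L : E →L[ℝ] F) : IsDerivFamily d J (fun k x => L (D k x)) :=
  fun k hk x hx => L.hasFDerivAt.comp_hasDerivAt x (hD k hk x hx)

/-- The factor `2` counts real and imaginary part; `2 ^ q` comes from the `q`-th power of their sum.
-/
def radConstC (d : ℕ) (q : ℝ) : ℝ := 2 ^ q * (2 * radConst d q)

theorem radConstC_nonneg {d : ℕ} {q : ℝ} (hq : q * (1 - 1 / d) < 1) : 0 ≤ radConstC d q := by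
  have := radConst_nonneg hq
  unfold radConstC; positivity

theorem IsDerivFamily.aemeasurable_radSpeed {E : Type*} [NormedAddCommGroup E] [NormedSpace ℝ E]
    {d e : ℕ} {J : Set ℝ} (hJ : MeasurableSet J) {D : ℕ → ℝ → E} (hd : 2 ≤ d)
    (hD : IsDerivFamily d J D) :
    AEMeasurable (fun x => radSpeed e (D 0 x) (D 1 x)) (volume.restrict J) := by
  have hm0 : AEMeasurable (fun x => ‖D 0 x‖) (volume.restrict J) :=
    ContinuousOn.aemeasurable (fun x hx =>
      (hD 0 (by omega) x hx).continuousAt.norm.continuousWithinAt) hJ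
  have hm1 : AEMeasurable (fun x => ‖D 1 x‖) (volume.restrict J) :=
    ContinuousOn.aemeasurable (fun x hx =>
      (hD 1 (by omega) x hx).continuousAt.norm.continuousWithinAt) hJ
  exact hm1.mul (hm0.pow_const _)

theorem lintegral_radSpeed_le_one {d : ℕ} {q : ℝ} (hd : 2 ≤ d) (hq1 : 1 ≤ q)
    (hq : q * (1 - 1 / d) < 1) {a b : ℝ} (hab : a < b) {D : ℕ → ℝ → ℂ}
    (hD : IsDerivFamily d (Ioo a b) D) (hd1 : ∀ x ∈ Ioo a b, ‖D d x‖ ≤ 1)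
    (h0 : ∀ x ∈ Ioo a b, ‖D 0 x‖ ≤ (4 * (b - a)) ^ d)
    (h1 : ∀ x ∈ Ioo a b, ‖D 1 x‖ ≤ (4 * (b - a)) ^ (d - 1)) :
    ∫⁻ x in Ioo a b, ENNReal.ofReal (radSpeed d (D 0 x) (D 1 x) ^ q) ≤
      ENNReal.ofReal (radConstC d q * (b - a)) := by
  have hre := hD.clm_comp Complex.reCLM
  have him := hD.clm_comp Complex.imCLM
  have ire := lintegral_radSpeed_le_real hd hq1 hq hab hre
    (fun x hx => (Complex.abs_re_le_norm _).trans (hd1 x hx))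
    (fun x hx => (Complex.abs_re_le_norm _).trans (h0 x hx))
    (fun x hx => (Complex.abs_re_le_norm _).trans (h1 x hx))
  have iim := lintegral_radSpeed_le_real hd hq1 hq hab him
    (fun x hx => (Complex.abs_im_le_norm _).trans (hd1 x hx))
    (fun x hx => (Complex.abs_im_le_norm _).trans (h0 x hx))
    (fun x hx => (Complex.abs_im_le_norm _).trans (h1 x hx))
  simp only [Complex.reCLM_apply, Complex.imCLM_apply] at ire iim
  have hC := radConst_nonneg hq
  have hl : 0 < b - a := by linarith
  have mre : AEMeasurable (fun x => ENNReal.ofReal (radSpeed d (D 0 x).re (D 1 x).re ^ q))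
      (volume.restrict (Ioo a b)) :=
    ((hre.aemeasurable_radSpeed measurableSet_Ioo hd).pow_const q).ennreal_ofReal
  calc _ ≤ ∫⁻ x in Ioo a b, ENNReal.ofReal (2 ^ q) *
        (ENNReal.ofReal (radSpeed d (D 0 x).re (D 1 x).re ^ q) +
          ENNReal.ofReal (radSpeed d (D 0 x).im (D 1 x).im ^ q)) := by
        refine lintegral_mono_ae ?_
        filter_upwards [ae_restrict_mem measurableSet_Ioo,
          ae_restrict_of_ae (ae_deriv_eq_zero_of_eq_zero (hre 0 (by omega))),
          ae_restrict_of_ae (ae_deriv_eq_zero_of_eq_zero (him 0 (by omega)))] with x hx e1 e2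
        have n1 := Real.rpow_nonneg (radSpeed_nonneg d (D 0 x).re (D 1 x).re) q
        have n2 := Real.rpow_nonneg (radSpeed_nonneg d (D 0 x).im (D 1 x).im) q
        rw [← ENNReal.ofReal_add n1 n2, ← ENNReal.ofReal_mul (by positivity)]
        refine ENNReal.ofReal_le_ofReal (le_trans ?_ (add_rpow_le_two_rpow_mul
          (radSpeed_nonneg _ _ _) (radSpeed_nonneg _ _ _) (by linarith)))
        exact Real.rpow_le_rpow (radSpeed_nonneg _ _ _)
          (radSpeed_complex_le hd (e1 hx) (e2 hx)) (by linarith)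
    _ ≤ ENNReal.ofReal (2 ^ q) * (ENNReal.ofReal (radConst d q * (b - a)) +
          ENNReal.ofReal (radConst d q * (b - a))) := by
        rw [lintegral_const_mul' _ _ ENNReal.ofReal_ne_top, lintegral_add_left' mre]
        gcongr
    _ = _ := by
        rw [← ENNReal.ofReal_add (by positivity) (by positivity),
          ← ENNReal.ofReal_mul (by positivity), radConstC]
        congr 1; ring

/-- The main estimate: the `L^q` norm of the speed of the `d`-th roots of a function of class
`C^d` on an interval, for `q < d/(d-1)`, in a form that is invariant under scaling. -/
theorem lintegral_radSpeed_le {d : ℕ} {q A : ℝ} (hd : 2 ≤ d) (hq1 : 1 ≤ q)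
    (hq : q * (1 - 1 / d) < 1) (hA : 0 < A) {a b : ℝ} (hab : a < b) {D : ℕ → ℝ → ℂ}
    (hD : IsDerivFamily d (Ioo a b) D) (hd1 : ∀ x ∈ Ioo a b, ‖D d x‖ ≤ A)
    (h0 : ∀ x ∈ Ioo a b, ‖D 0 x‖ ≤ A * (4 * (b - a)) ^ d)
    (h1 : ∀ x ∈ Ioo a b, ‖D 1 x‖ ≤ A * (4 * (b - a)) ^ (d - 1)) :
    ∫⁻ x in Ioo a b, ENNReal.ofReal (radSpeed d (D 0 x) (D 1 x) ^ q) ≤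
      ENNReal.ofReal ((A ^ ((1 : ℝ) / d)) ^ q * (radConstC d q * (b - a))) := by
  have hs : ∀ z : ℂ, ∀ r : ℝ, ‖z‖ ≤ A * r → ‖A⁻¹ • z‖ ≤ r := by
    intro z r h
    rw [norm_smul, Real.norm_of_nonneg (by positivity), inv_mul_le_iff₀ hA]
    exact h
  have h := lintegral_radSpeed_le_one hd hq1 hq hab (D := fun k x => A⁻¹ • D k x)
    (fun k hk x hx => (hD k hk x hx).const_smul A⁻¹)
    (fun x hx => hs _ _ (by simpa using hd1 x hx))
    (fun x hx => hs _ _ (h0 x hx)) (fun x hx => hs _ _ (h1 x hx))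
  rw [ENNReal.ofReal_mul (by positivity)]
  refine le_trans (le_of_eq ?_) (mul_le_mul_right h _)
  rw [← lintegral_const_mul' _ _ ENNReal.ofReal_ne_top]
  refine lintegral_congr fun x => ?_
  have hn := radSpeed_nonneg d (A⁻¹ • D 0 x) (A⁻¹ • D 1 x)
  rw [← ENNReal.ofReal_mul (by positivity), ← Real.mul_rpow (by positivity) hn,
    ← radSpeed_smul hA, smul_smul, smul_smul, mul_inv_cancel₀ hA.ne', one_smul, one_smul]

/-! ### Weak derivatives of absolutely continuous functions -/

theorem absolutelyContinuousOnInterval_of_dist_le {X Y : Type*} [PseudoMetricSpace X]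
    [PseudoMetricSpace Y] {u : ℝ → X} {G : ℝ → Y} {a b : ℝ}
    (hG : AbsolutelyContinuousOnInterval G a b)
    (h : ∀ x ∈ uIcc a b, ∀ y ∈ uIcc a b, dist (u x) (u y) ≤ dist (G x) (G y)) :
    AbsolutelyContinuousOnInterval u a b := by
  rw [absolutelyContinuousOnInterval_iff] at hG ⊢
  intro ε hε
  obtain ⟨δ, hδ, H⟩ := hG ε hε
  refine ⟨δ, hδ, fun E hE hlt => (Finset.sum_le_sum fun i hi => ?_).trans_lt (H E hE hlt)⟩
  exact h _ (hE.1 i hi).1 _ (hE.1 i hi).2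

/-- The increments of `u` on `(a, b)` are bounded by the integral of `φ`. -/
def IncrementBound {X : Type*} [PseudoMetricSpace X] (a b : ℝ) (φ : ℝ → ℝ) (u : ℝ → X) : Prop :=
  ∀ x y, a < x → x ≤ y → y < b → dist (u x) (u y) ≤ ∫ t in x..y, φ t

theorem intervalIntegrable_of_integrableOn_Ioo {E : Type*} [NormedAddCommGroup E] {a b : ℝ}
    {φ : ℝ → E} (h : IntegrableOn φ (Ioo a b)) {x y : ℝ} (hx : x ∈ Icc a b) (hy : y ∈ Icc a b) :
    IntervalIntegrable φ volume x y := by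
  rw [intervalIntegrable_iff']
  exact ((integrableOn_Icc_iff_integrableOn_Ioo).2 h).mono_set (uIcc_subset_Icc hx hy)

/-- In this form `u` inherits continuity and absolute continuity from the primitive of `φ`. -/
theorem IncrementBound.dist_le_dist_integral {X : Type*} [PseudoMetricSpace X] {a b : ℝ}
    {φ : ℝ → ℝ} {u : ℝ → X} (h : IncrementBound a b φ u) (hφ : IntegrableOn φ (Ioo a b))
    {x y : ℝ} (hx : a < x) (hxy : x ≤ y) (hy : y < b) :
    ∀ s ∈ Icc x y, ∀ t ∈ Icc x y,
      dist (u s) (u t) ≤ dist (∫ v in x..s, φ v) (∫ v in x..t, φ v) := by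
  have hi : ∀ s ∈ Icc x y, IntervalIntegrable φ volume x s := fun s hs =>
    intervalIntegrable_of_integrableOn_Ioo hφ ⟨hx.le, hxy.trans hy.le⟩
      ⟨hx.le.trans hs.1, hs.2.trans hy.le⟩
  have key : ∀ s ∈ Icc x y, ∀ t ∈ Icc x y, s ≤ t →
      dist (u s) (u t) ≤ dist (∫ v in x..s, φ v) (∫ v in x..t, φ v) := by
    intro s hs t ht hst
    have := h s t (hx.trans_le hs.1) hst (ht.2.trans_lt hy)
    rw [dist_comm (∫ v in x..s, φ v), Real.dist_eq,
      intervalIntegral.integral_interval_sub_left (hi t ht) (hi s hs)]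
    exact this.trans (le_abs_self _)
  intro s hs t ht
  rcases le_total s t with hst | hst
  · exact key s hs t ht hst
  · rw [dist_comm (u s), dist_comm (∫ v in x..s, φ v)]
    exact key t ht s hs hst

theorem IncrementBound.absolutelyContinuous {X : Type*} [PseudoMetricSpace X] {a b : ℝ}
    {φ : ℝ → ℝ} {u : ℝ → X} (h : IncrementBound a b φ u) (hφ : IntegrableOn φ (Ioo a b))
    {x y : ℝ} (hx : a < x) (hxy : x ≤ y) (hy : y < b) :
    AbsolutelyContinuousOnInterval u x y := by
  have hi : IntervalIntegrable φ volume x y :=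
    intervalIntegrable_of_integrableOn_Ioo hφ ⟨hx.le, hxy.trans hy.le⟩
      ⟨hx.le.trans hxy, hy.le⟩
  refine absolutelyContinuousOnInterval_of_dist_le
    (hi.absolutelyContinuousOnInterval_intervalIntegral (c := x) left_mem_uIcc) ?_
  rw [uIcc_of_le hxy]
  exact h.dist_le_dist_integral hφ hx hxy hy

theorem IncrementBound.continuousOn {X : Type*} [PseudoMetricSpace X] {a b : ℝ}
    {φ : ℝ → ℝ} {u : ℝ → X} (h : IncrementBound a b φ u) (hφ : IntegrableOn φ (Ioo a b)) :
    ContinuousOn u (Ioo a b) := by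
  refine continuousOn_of_forall_continuousAt fun x hx => ?_
  obtain ⟨s, hs⟩ := exists_between hx.1
  obtain ⟨t, ht⟩ := exists_between hx.2
  have hst : s ≤ t := (hs.2.trans ht.1).le
  have hxs : x ∈ Icc s t := ⟨hs.2.le, ht.1.le⟩
  have hG : ContinuousOn (fun y => ∫ v in s..y, φ v) (Icc s t) := by
    have := intervalIntegral.continuousOn_primitive_interval (a := s) (b := t) (μ := volume)
      (f := φ) (by
        rw [uIcc_of_le hst, integrableOn_Icc_iff_integrableOn_Ioo]
        exact hφ.mono_set (Ioo_subset_Ioo hs.1.le ht.2.le))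
    rwa [uIcc_of_le hst] at this
  have hGx := hG.continuousAt (Icc_mem_nhds hs.2 ht.1)
  rw [ContinuousAt, tendsto_iff_dist_tendsto_zero] at hGx ⊢
  refine squeeze_zero' (Eventually.of_forall fun _ => dist_nonneg) ?_ hGx
  filter_upwards [Icc_mem_nhds hs.2 ht.1] with y hy
  exact h.dist_le_dist_integral hφ hs.1 hst ht.2 y hy x hxs

/-- Compare right-hand slopes of `u` with those of the primitive of `φ`, which has derivative `φ x`
at almost every `x`. Where `u` is not differentiable, `deriv u` is `0` and the bound is trivial. -/
theorem IncrementBound.ae_norm_deriv_le {E : Type*} [NormedAddCommGroup E] [NormedSpace ℝ E]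
    {a b : ℝ} {φ : ℝ → ℝ} {u : ℝ → E} (h : IncrementBound a b φ u)
    (hφ : IntegrableOn φ (Ioo a b)) (hφ0 : ∀ x, 0 ≤ φ x) :
    ∀ᵐ x, x ∈ Ioo a b → ‖deriv u x‖ ≤ φ x := by
  rcases le_or_gt b a with hab | hab
  · simp [Ioo_eq_empty hab.not_gt]
  have hI : ∀ s ∈ Icc a b, ∀ t ∈ Icc a b, IntervalIntegrable φ volume s t := fun s hs t ht =>
    intervalIntegrable_of_integrableOn_Ioo hφ hs ht
  have ha : a ∈ Icc a b := left_mem_Icc.2 hab.le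
  filter_upwards [(hI a ha b (right_mem_Icc.2 hab.le)).ae_hasDerivAt_integral] with x hx hxI
  rw [uIcc_of_le hab.le] at hx
  have hG := hx (Ioo_subset_Icc_self hxI) a ha
  by_cases hd : DifferentiableAt ℝ u x
  · have h1 := (hasDerivWithinAt_iff_tendsto_slope' self_notMem_Ioi).1
      (hd.hasDerivAt.hasDerivWithinAt (s := Ioi x))
    have h2 := (hasDerivWithinAt_iff_tendsto_slope' self_notMem_Ioi).1
      (hG.hasDerivWithinAt (s := Ioi x))
    refine le_of_tendsto_of_tendsto h1.norm h2 ?_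
    filter_upwards [Ioo_mem_nhdsGT hxI.2] with y hy
    have hyI : y ∈ Icc a b := ⟨(hxI.1.trans hy.1).le, hy.2.le⟩
    rw [slope_def_module, slope_def_module, norm_smul, smul_eq_mul,
      intervalIntegral.integral_interval_sub_left (hI a ha y hyI)
        (hI a ha x (Ioo_subset_Icc_self hxI)), norm_inv, Real.norm_of_nonneg (by linarith [hy.1])]
    refine mul_le_mul_of_nonneg_left ?_ (inv_nonneg.2 (by linarith [hy.1]))
    rw [← dist_eq_norm, dist_comm]
    exact h x y hxI.1 hy.1.le hy.2
  · rw [deriv_zero_of_not_differentiableAt hd, norm_zero]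
    exact hφ0 x

theorem integrableOn_of_ae_norm_le {E : Type*} [NormedAddCommGroup E] [NormedSpace ℝ E]
    [CompleteSpace E] [MeasurableSpace E] [BorelSpace E] [SecondCountableTopology E]
    {a b : ℝ} {φ : ℝ → ℝ} {u : ℝ → E}
    (hφ : IntegrableOn φ (Ioo a b)) (h : ∀ᵐ x, x ∈ Ioo a b → ‖deriv u x‖ ≤ φ x) :
    IntegrableOn (deriv u) (Ioo a b) :=
  Integrable.mono' hφ (measurable_deriv u).aestronglyMeasurable
    ((ae_restrict_iff' measurableSet_Ioo).2 h)

/-- A test function on an open interval is supported in a compact subinterval. -/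
theorem exists_Icc_of_tsupport_subset_Ioo {a b : ℝ} (hab : a < b) {ψ : ℝ → ℝ}
    (hc : HasCompactSupport ψ) (hs : tsupport ψ ⊆ Ioo a b) :
    ∃ s t, a < s ∧ s ≤ t ∧ t < b ∧ tsupport ψ ⊆ Ioo s t := by
  rcases (tsupport ψ).eq_empty_or_nonempty with h | h
  · obtain ⟨s, hs⟩ := exists_between hab
    exact ⟨s, s, hs.1, le_rfl, hs.2, by simp [h]⟩
  · have hK : IsCompact (tsupport ψ) := hc
    have h1 := hs (hK.sInf_mem h)
    have h2 := hs (hK.sSup_mem h)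
    obtain ⟨s, hs1, hs2⟩ := exists_between h1.1
    obtain ⟨t, ht1, ht2⟩ := exists_between h2.2
    have hsub : tsupport ψ ⊆ Ioo s t := fun x hx =>
      ⟨hs2.trans_le (csInf_le hK.bddBelow hx), (le_csSup hK.bddAbove hx).trans_lt ht1⟩
    obtain ⟨x, hx⟩ := h
    exact ⟨s, t, hs1, ((hsub hx).1.trans (hsub hx).2).le, ht2, hsub⟩

/-- Integration by parts for absolutely continuous functions on a compact interval `[s, t]` inside
`(a, b)` that contains the support of the test function, so the boundary terms vanish. -/
theorem IncrementBound.hasWeakDerivOn {a b : ℝ} (hab : a < b) {φ : ℝ → ℝ} {u : ℝ → ℝ}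
    (h : IncrementBound a b φ u) (hφ : IntegrableOn φ (Ioo a b)) (hφ0 : ∀ x, 0 ≤ φ x) :
    HasWeakDerivOn (Ioo a b) u (deriv u) := by
  refine ⟨(h.continuousOn hφ).locallyIntegrableOn measurableSet_Ioo,
    (integrableOn_of_ae_norm_le hφ (h.ae_norm_deriv_le hφ hφ0)).locallyIntegrableOn, ?_⟩
  intro ψ hψ hc hs
  obtain ⟨s, t, has, hst, htb, hsub⟩ := exists_Icc_of_tsupport_subset_Ioo hab hc hs
  have hψ0 : ∀ x ∉ Ioo s t, ψ x = 0 := fun x hx => image_eq_zero_of_notMem_tsupport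
    fun h => hx (hsub h)
  have hψ0' : ∀ x ∉ Ioo s t, deriv ψ x = 0 := fun x hx => image_eq_zero_of_notMem_tsupport
    fun h => hx (hsub (tsupport_deriv_subset h))
  have hres : ∀ F : ℝ → ℝ, (∀ x ∉ Ioo s t, F x = 0) →
      ∫ x in Ioo a b, F x = ∫ x in s..t, F x := by
    intro F hF
    rw [intervalIntegral.integral_of_le hst, integral_Ioc_eq_integral_Ioo]
    exact setIntegral_eq_of_subset_of_forall_sdiff_eq_zero measurableSet_Ioo
      (Ioo_subset_Ioo has.le htb.le) fun x hx => hF x hx.2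
  rw [hres _ fun x hx => by rw [hψ0' x hx, zero_smul],
    hres _ fun x hx => by rw [hψ0 x hx, zero_smul]]
  have hψac : AbsolutelyContinuousOnInterval ψ s t :=
    (hψ.of_le (by exact_mod_cast le_top)).contDiffOn.absolutelyContinuousOnInterval
  have := hψac.integral_mul_deriv_eq_deriv_mul (h.absolutelyContinuous hφ has hst htb)
  simp only [smul_eq_mul]
  rw [this, hψ0 s (by simp), hψ0 t (by simp)]
  ring

theorem IncrementBound.clm_comp {E F : Type*} [NormedAddCommGroup E] [NormedSpace ℝ E]
    [NormedAddCommGroup F] [NormedSpace ℝ F] {a b : ℝ} {φ : ℝ → ℝ} {u : ℝ → E}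
    (h : IncrementBound a b φ u) (L : E →L[ℝ] F) (hL : ∀ z, ‖L z‖ ≤ ‖z‖) :
    IncrementBound a b φ (fun x => L (u x)) := by
  intro x y hx hxy hy
  refine le_trans ?_ (h x y hx hxy hy)
  rw [dist_eq_norm, dist_eq_norm, ← map_sub]
  exact hL _

theorem IncrementBound.hasWeakDerivOn_complex {a b : ℝ} (hab : a < b) {φ : ℝ → ℝ} {u : ℝ → ℂ}
    (h : IncrementBound a b φ u) (hφ : IntegrableOn φ (Ioo a b)) (hφ0 : ∀ x, 0 ≤ φ x)
    (hd : ∀ᵐ x, x ∈ Ioo a b → DifferentiableAt ℝ u x) :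
    HasWeakDerivOn (Ioo a b) u (deriv u) := by
  have hI := integrableOn_of_ae_norm_le hφ (h.ae_norm_deriv_le hφ hφ0)
  have hc := h.continuousOn hφ
  refine ⟨hc.locallyIntegrableOn measurableSet_Ioo, hI.locallyIntegrableOn, ?_⟩
  intro ψ hψ hcs hs
  have hψd : Continuous (deriv ψ) := hψ.continuous_deriv (by exact_mod_cast le_top)
  have i1 : IntegrableOn (fun x => deriv ψ x • u x) (Ioo a b) := by
    obtain ⟨s, t, has, hst, htb, hsub⟩ := exists_Icc_of_tsupport_subset_Ioo hab hcs hs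
    have hK : Icc s t ⊆ Ioo a b := fun x hx => ⟨has.trans_le hx.1, hx.2.trans_lt htb⟩
    refine IntegrableOn.of_forall_sdiff_eq_zero (s := Icc s t)
      ((hψd.continuousOn.smul (hc.mono hK)).integrableOn_Icc) measurableSet_Ioo ?_
    intro x hx
    rw [image_eq_zero_of_notMem_tsupport (f := deriv ψ) fun hh =>
      hx.2 (Ioo_subset_Icc_self (hsub (tsupport_deriv_subset hh))), zero_smul]
  have i2 : IntegrableOn (fun x => ψ x • deriv u x) (Ioo a b) := by
    obtain ⟨C, hC⟩ := hψ.continuous.bounded_above_of_compact_support hcs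
    exact hI.bdd_smul C hψ.continuous.aestronglyMeasurable.restrict (ae_of_all _ hC)
  -- Reduction to the real case through `re` and `im`. Differentiability almost everywhere is needed
  -- to identify the derivative of `L ∘ u` with `L` applied to `deriv u`.
  have key : ∀ L : ℂ →L[ℝ] ℝ, (∀ z, ‖L z‖ ≤ ‖z‖) →
      L (∫ x in Ioo a b, deriv ψ x • u x) = L (-∫ x in Ioo a b, ψ x • deriv u x) := by
    intro L hL
    have hw := ((h.clm_comp L hL).hasWeakDerivOn hab hφ hφ0).2.2 ψ hψ hcs hs
    rw [map_neg, ← L.integral_comp_comm i1, ← L.integral_comp_comm i2]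
    simp only [map_smul]
    rw [hw]
    congr 1
    refine setIntegral_congr_ae measurableSet_Ioo ?_
    filter_upwards [hd] with x hx hxI
    have hL' := (L.hasFDerivAt.comp_hasDerivAt x (hx hxI).hasDerivAt).deriv
    exact congrArg (ψ x • ·) hL'
  apply Complex.ext
  · exact key Complex.reCLM fun z => Complex.abs_re_le_norm z
  · exact key Complex.imCLM fun z => Complex.abs_im_le_norm z

/-! ### Continuous radicals -/

theorem norm_eq_rpow_of_pow_eq {d : ℕ} (hd : 2 ≤ d) {a y : ℂ} (h : a ^ d = y) :
    ‖a‖ = ‖y‖ ^ ((1 : ℝ) / d) := by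
  rw [← h, norm_pow, one_div, Real.pow_rpow_inv_natCast (norm_nonneg _) (by omega)]

theorem norm_root_deriv {d : ℕ} (hd : 2 ≤ d) {a y : ℂ} (h : a ^ d = y) (y' : ℂ) :
    ‖a * (y' / y) / d‖ = radSpeed d y y' / d := by
  rw [norm_div, Complex.norm_natCast, norm_mul, norm_div, norm_eq_rpow_of_pow_eq hd h, radSpeed]
  congr 1
  rcases (norm_nonneg y).eq_or_lt with hy | hy
  · rw [← hy, Real.zero_rpow (one_div_sub_one_neg hd).ne]; simp
  · rw [Real.rpow_sub_one hy.ne']; ring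

theorem hasDerivAt_root {d : ℕ} (hd : 2 ≤ d) {lam h : ℝ → ℂ} {h' : ℂ} {x : ℝ}
    (hl : ContinuousAt lam x) (hlh : ∀ᶠ t in 𝓝 x, lam t ^ d = h t) (hh : HasDerivAt h h' x)
    (h0 : h x ≠ 0) : HasDerivAt lam (lam x * (h' / h x) / d) x := by
  have hx : lam x ^ d = h x := hlh.self_of_nhds
  have hl0 : lam x ≠ 0 := fun h1 => h0 (by rw [← hx, h1, zero_pow (by omega)])
  have hd0 : (d : ℂ) ≠ 0 := by exact_mod_cast (by omega : d ≠ 0)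
  -- `(lam t - lam x) * S t = h t - h x`, and `S` is continuous at `x` with `S x = d * lam x ^ (d -
  -- 1) ≠ 0`; dividing difference quotients by `S` gives the derivative.
  set S : ℝ → ℂ := fun t => ∑ i ∈ Finset.range d, lam t ^ i * lam x ^ (d - 1 - i) with hS
  have hSc : ContinuousAt S x := by
    rw [hS]; fun_prop
  have hSx : S x = d * lam x ^ (d - 1) := by
    rw [hS]
    simp only
    rw [Finset.sum_congr rfl (g := fun _ => lam x ^ (d - 1))]
    · simp
    · intro i hi
      rw [← pow_add]
      congr 1
      have := Finset.mem_range.1 hi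
      omega
  have hSx0 : S x ≠ 0 := by rw [hSx]; exact mul_ne_zero hd0 (pow_ne_zero _ hl0)
  rw [hasDerivAt_iff_tendsto_slope] at hh ⊢
  have e : lam x * (h' / h x) / d = h' / S x := by
    rw [hSx, ← hx, show lam x ^ d = lam x ^ (d - 1) * lam x by
      rw [← pow_succ]; congr 1; omega]
    field_simp
  rw [e]
  refine (hh.div (hSc.tendsto.mono_left nhdsWithin_le_nhds) hSx0).congr' ?_
  filter_upwards [hlh.filter_mono nhdsWithin_le_nhds,
    (hSc.eventually_ne hSx0).filter_mono nhdsWithin_le_nhds] with t ht hS0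
  have hg := geom_sum₂_mul (lam t) (lam x) d
  rw [ht, hx] at hg
  change S t * _ = _ at hg
  rw [Pi.div_apply, slope_def_module, slope_def_module, ← hg, Complex.real_smul,
    Complex.real_smul]
  field_simp

/-- At a flat point `D 0 t = o(|t - x|^d)`, so every root, continuous or not, is `o(|t - x|)`. -/
theorem hasDerivAt_root_of_flat {d : ℕ} (hd : 2 ≤ d) {J : Set ℝ} (hJ : IsOpen J)
    {D : ℕ → ℝ → ℂ} (hD : IsDerivFamily d J D) (hc : ContinuousOn (D d) J) {lam : ℝ → ℂ}
    (hl : ∀ t ∈ J, lam t ^ d = D 0 t) {x : ℝ} (hx : x ∈ J) (h0 : ∀ k ≤ d, D k x = 0) :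
    HasDerivAt lam 0 x := by
  have hlx : lam x = 0 := by
    have := hl x hx
    rw [h0 0 (by omega)] at this
    exact pow_eq_zero_iff (by omega) |>.1 this
  rw [hasDerivAt_iff_isLittleO, Asymptotics.isLittleO_iff]
  intro c hc0
  have hcx := hc.continuousAt (hJ.mem_nhds hx)
  -- The divisor `4` is matched to the interval `(x - ρ, x + ρ)` below, whose length is `4 |t - x|`:
  -- it yields `‖lam t‖ ^ d ≤ (c / 4 * (4 |t - x|)) ^ d`.
  have hsm : ∀ᶠ t in 𝓝 x, ‖D d t‖ ≤ (c / 4) ^ d := by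
    have := hcx.norm
    rw [ContinuousAt, h0 d le_rfl, norm_zero] at this
    exact (this.eventually_lt_const (by positivity)).mono fun _ h => h.le
  obtain ⟨r, hr, hrs⟩ := Metric.mem_nhds_iff.1 (Filter.inter_mem hsm (hJ.mem_nhds hx))
  filter_upwards [Metric.ball_mem_nhds x (half_pos hr)] with t ht
  rw [hlx]
  simp only [sub_zero, smul_zero]
  rcases eq_or_ne t x with rfl | hne
  · simp [hlx]
  have ht0 : 0 < |t - x| := abs_pos.2 (sub_ne_zero.2 hne)
  rw [Metric.mem_ball, Real.dist_eq] at ht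
  set ρ := 2 * |t - x| with hρ
  have hsub : Ioo (x - ρ) (x + ρ) ⊆ Metric.ball x r := by
    rw [← Real.ball_eq_Ioo]; exact Metric.ball_subset_ball (by linarith)
  have hb := (hD.mono le_rfl (J' := Ioo (x - ρ) (x + ρ))
    fun s hs => (hrs (hsub hs)).2).norm_le_of_zeros (m := 0) (k := 0) (A := (c / 4) ^ d)
    (by linarith) (by positivity)
    (fun s hs => (hrs (hsub hs)).1)
    (fun k _ hk => ⟨x, ⟨by linarith, by linarith⟩, h0 k hk.le⟩) le_rfl (by omega) t
    (by constructor <;> linarith [neg_abs_le (t - x), le_abs_self (t - x)])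
  rw [← hl t (hrs (hsub ⟨by linarith [neg_abs_le (t - x)], by linarith [le_abs_self (t - x)]⟩)).2,
    norm_pow, Nat.sub_zero, ← mul_pow] at hb
  have := le_of_pow_le_pow_left₀ (by omega) (by
    have : 0 ≤ x + ρ - (x - ρ) := by linarith
    positivity) hb
  rw [Real.norm_eq_abs]
  linarith

/-- A continuous `d`-th root of a differentiable function without zeros on an open interval. -/
theorem exists_continuous_root {d : ℕ} (hd : 2 ≤ d) {a b : ℝ} (hab : a < b) {h h' : ℝ → ℂ}
    (hh : ∀ x ∈ Ioo a b, HasDerivAt h (h' x) x) (hc : ContinuousOn h' (Ioo a b))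
    (h0 : ∀ x ∈ Ioo a b, h x ≠ 0) :
    ∃ lam : ℝ → ℂ, ContinuousOn lam (Ioo a b) ∧ ∀ x ∈ Ioo a b, lam x ^ d = h x := by
  obtain ⟨c, hcI⟩ := exists_between hab
  have hd0 : (d : ℂ) ≠ 0 := by exact_mod_cast (by omega : d ≠ 0)
  obtain ⟨z, hz⟩ := IsAlgClosed.exists_pow_nat_eq (h c) (n := d) (by omega)
  have hκ : ContinuousOn (fun t => h' t / h t) (Ioo a b) :=
    hc.div (fun x hx => (hh x hx).continuousAt.continuousWithinAt) h0
  -- `L` is a logarithm of `h / h c`: the function `h * exp (-L)` has derivative zero. The root is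
  -- then `z * exp (L / d)`.
  set L : ℝ → ℂ := fun x => ∫ t in c..x, h' t / h t with hL
  have hLd : ∀ x ∈ Ioo a b, HasDerivAt L (h' x / h x) x := by
    intro x hx
    refine intervalIntegral.integral_hasDerivAt_right ?_
      (hκ.stronglyMeasurableAtFilter isOpen_Ioo x hx) (hκ.continuousAt (isOpen_Ioo.mem_nhds hx))
    exact (hκ.mono (ordConnected_Ioo.uIcc_subset hcI hx)).intervalIntegrable
  have hder : ∀ x ∈ Ioo a b, HasDerivAt (fun t => h t * Complex.exp (-L t)) 0 x := by
    intro x hx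
    have e : h' x * Complex.exp (-L x) + h x * (Complex.exp (-L x) * -(h' x / h x)) = 0 := by
      have := h0 x hx
      field_simp
      ring
    have := (hh x hx).mul ((hLd x hx).neg.cexp)
    rw [Pi.neg_apply, e] at this
    exact this
  have hconst : ∀ x ∈ Ioo a b, h x * Complex.exp (-L x) = h c := by
    intro x hx
    have := isOpen_Ioo.is_const_of_deriv_eq_zero isPreconnected_Ioo
      (fun t ht => (hder t ht).differentiableAt.differentiableWithinAt)
      (fun t ht => (hder t ht).deriv) hx hcI
    simpa [hL] using this
  refine ⟨fun x => z * Complex.exp (L x / d), fun x hx => ?_, fun x hx => ?_⟩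
  · have := (hLd x hx).continuousAt
    exact (continuousAt_const.mul (this.div_const _).cexp).continuousWithinAt
  · simp only
    rw [mul_pow, hz, ← Complex.exp_nat_mul, mul_div_cancel₀ _ hd0, ← hconst x hx, mul_assoc,
      ← Complex.exp_add]
    simp

/-- Increments of a continuous radical on an interval without zeros. -/
theorem dist_root_le_of_ne_zero {d : ℕ} (hd : 2 ≤ d) {a b : ℝ} {D : ℕ → ℝ → ℂ}
    (hD : IsDerivFamily d (Ioo a b) D) {lam : ℝ → ℂ} (hl : ContinuousOn lam (Ioo a b))
    (hlD : ∀ x ∈ Ioo a b, lam x ^ d = D 0 x) {x y : ℝ} (hx : a < x) (hxy : x ≤ y) (hy : y < b)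
    (h0 : ∀ t ∈ Icc x y, D 0 t ≠ 0) :
    dist (lam x) (lam y) ≤ ∫ t in x..y, radSpeed d (D 0 t) (D 1 t) / d := by
  have hsub : Icc x y ⊆ Ioo a b := fun t ht => ⟨hx.trans_le ht.1, ht.2.trans_lt hy⟩
  have hder : ∀ t ∈ uIcc x y, HasDerivAt lam (lam t * (D 1 t / D 0 t) / d) t := by
    rw [uIcc_of_le hxy]
    intro t ht
    have hn := isOpen_Ioo.mem_nhds (hsub ht)
    exact hasDerivAt_root hd (hl.continuousAt hn) (by filter_upwards [hn] with s hs using hlD s hs)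
      (hD 0 (by omega) t (hsub ht)) (h0 t ht)
  have hc : ∀ k < d, ContinuousOn (D k) (Icc x y) := fun k hk t ht =>
    (hD k hk t (hsub ht)).continuousAt.continuousWithinAt
  have hint : IntervalIntegrable (fun t => lam t * (D 1 t / D 0 t) / d) volume x y := by
    refine ContinuousOn.intervalIntegrable ?_
    rw [uIcc_of_le hxy]
    exact ((hl.mono hsub).mul ((hc 1 (by omega)).div (hc 0 (by omega)) h0)).div_const _
  rw [dist_comm, dist_eq_norm, ← intervalIntegral.integral_eq_sub_of_hasDerivAt hder hint]
  refine (intervalIntegral.norm_integral_le_integral_norm hxy).trans (le_of_eq ?_)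
  refine intervalIntegral.integral_congr fun t ht => ?_
  rw [uIcc_of_le hxy] at ht
  exact norm_root_deriv hd (hlD t (hsub ht)) _

/-- If the increments of a continuous `f` on intervals without zeros are bounded by those of a
monotone `G`, then so is the value of `f` at the left of a zero. -/
theorem norm_le_of_zero_right {E : Type*} [NormedAddCommGroup E] {f : ℝ → E} {G : ℝ → ℝ}
    {s t : ℝ} (hst : s ≤ t) (hf : ContinuousOn f (Icc s t)) (hG : MonotoneOn G (Icc s t))
    (h : ∀ x y, s ≤ x → x ≤ y → y ≤ t → (∀ z ∈ Icc x y, f z ≠ 0) → ‖f x‖ ≤ ‖f y‖ + (G y - G x))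
    (h0 : f t = 0) : ‖f s‖ ≤ G t - G s := by
  have hK : IsCompact (Icc s t ∩ f ⁻¹' {0}) := isCompact_Icc.of_isClosed_subset
    (hf.preimage_isClosed_of_isClosed isClosed_Icc isClosed_singleton) inter_subset_left
  have hm := hK.sInf_mem ⟨t, right_mem_Icc.2 hst, h0⟩
  -- `r` is the first zero to the right of `s`. The bound holds on `[s, τ]` for every `τ < r`, and
  -- `τ → r` removes the term `‖f τ‖`.
  set r := sInf (Icc s t ∩ f ⁻¹' {0}) with hr
  have hr0 : f r = 0 := hm.2
  rcases hm.1.1.eq_or_lt with hsr | hsr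
  · rw [hsr, hr0, norm_zero, ← hsr]
    exact sub_nonneg.2 (hG (left_mem_Icc.2 hst) (right_mem_Icc.2 hst) hst)
  have hsub : Ioo s r ⊆ Icc s t := fun z hz => ⟨hz.1.le, hz.2.le.trans hm.1.2⟩
  have hlim : Tendsto (fun τ => ‖f τ‖ + (G t - G s)) (𝓝[Ioo s r] r)
      (𝓝 (‖f r‖ + (G t - G s))) := ((hf r hm.1).mono hsub).tendsto.norm.add_const _
  rw [hr0, norm_zero, zero_add] at hlim
  have : (𝓝[Ioo s r] r).NeBot := right_nhdsWithin_Ioo_neBot hsr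
  refine ge_of_tendsto hlim ?_
  filter_upwards [self_mem_nhdsWithin] with τ hτ
  have hz : ∀ z ∈ Icc s τ, f z ≠ 0 := fun z hz hz0 => by
    have hle : r ≤ z := csInf_le hK.bddBelow
      ⟨⟨hz.1, hz.2.trans (hτ.2.le.trans hm.1.2)⟩, hz0⟩
    exact absurd (hz.2.trans_lt hτ.2) hle.not_gt
  have h1 := h s τ le_rfl hτ.1.le (hsub hτ).2 hz
  have h2 := hG (hsub hτ) (right_mem_Icc.2 hst) (hsub hτ).2
  linarith

theorem norm_le_of_zero_left {E : Type*} [NormedAddCommGroup E] {f : ℝ → E} {G : ℝ → ℝ}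
    {s t : ℝ} (hst : s ≤ t) (hf : ContinuousOn f (Icc s t)) (hG : MonotoneOn G (Icc s t))
    (h : ∀ x y, s ≤ x → x ≤ y → y ≤ t → (∀ z ∈ Icc x y, f z ≠ 0) → ‖f y‖ ≤ ‖f x‖ + (G y - G x))
    (h0 : f s = 0) : ‖f t‖ ≤ G t - G s := by
  have hmaps : MapsTo (fun x : ℝ => -x) (Icc (-t) (-s)) (Icc s t) := fun x hx =>
    ⟨by linarith [hx.2], by linarith [hx.1]⟩
  have := norm_le_of_zero_right (f := fun x => f (-x)) (G := fun x => -G (-x)) (s := -t) (t := -s)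
    (by linarith) (hf.comp continuous_neg.continuousOn hmaps)
    (fun x hx y hy hxy => neg_le_neg (hG (hmaps hy) (hmaps hx) (neg_le_neg hxy)))
    (fun x y hx hxy hy hz => by
      have := h (-y) (-x) (by linarith) (by linarith) (by linarith) fun z hz' => by
        have := hz (-z) ⟨by linarith [hz'.2], by linarith [hz'.1]⟩
        rwa [neg_neg] at this
      linarith)
    (by simpa using h0)
  simp only [neg_neg] at this
  linarith

/-- Near an interval without zeros there is a continuous radical. -/
theorem exists_root_near_Icc {d : ℕ} (hd : 2 ≤ d) {a b : ℝ} {D : ℕ → ℝ → ℂ}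
    (hD : IsDerivFamily d (Ioo a b) D) {x y : ℝ} (hx : a < x) (hxy : x ≤ y) (hy : y < b)
    (h0 : ∀ t ∈ Icc x y, D 0 t ≠ 0) :
    ∃ a' b', a ≤ a' ∧ a' < x ∧ y < b' ∧ b' ≤ b ∧ ∃ lam : ℝ → ℂ, ContinuousOn lam (Ioo a' b') ∧
      ∀ t ∈ Ioo a' b', lam t ^ d = D 0 t := by
  have hc : ∀ k < d, ContinuousOn (D k) (Ioo a b) := fun k hk t ht =>
    (hD k hk t ht).continuousAt.continuousWithinAt
  have hU : IsOpen (Ioo a b ∩ D 0 ⁻¹' {0}ᶜ) :=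
    (hc 0 (by omega)).isOpen_inter_preimage isOpen_Ioo isOpen_compl_singleton
  have hxU := hU.mem_nhds ⟨⟨hx, hxy.trans_lt hy⟩, h0 x (left_mem_Icc.2 hxy)⟩
  have hyU := hU.mem_nhds ⟨⟨hx.trans_le hxy, hy⟩, h0 y (right_mem_Icc.2 hxy)⟩
  obtain ⟨a', ha', hsa⟩ := exists_Ioc_subset_of_mem_nhds' hxU hx
  obtain ⟨b', hb', hsb⟩ := exists_Ico_subset_of_mem_nhds' hyU hy
  have hsub : ∀ t ∈ Ioo a' b', t ∈ Ioo a b ∩ D 0 ⁻¹' {0}ᶜ := by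
    intro t ht
    rcases le_or_gt t x with h | h
    · exact hsa ⟨ht.1, h⟩
    rcases le_or_gt y t with h' | h'
    · exact hsb ⟨h', ht.2⟩
    · exact ⟨⟨hx.trans h, h'.trans hy⟩, h0 t ⟨h.le, h'.le⟩⟩
  have hsub' : Ioo a' b' ⊆ Ioo a b := fun t ht => (hsub t ht).1
  obtain ⟨lam, hl⟩ := exists_continuous_root hd (ha'.2.trans_le (hxy.trans hb'.1.le))
    (fun t ht => hD 0 (by omega) t (hsub' ht)) ((hc 1 (by omega)).mono hsub')
    (fun t ht => (hsub t ht).2)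
  exact ⟨a', b', ha'.1, ha'.2, hb'.1, hb'.2, lam, hl⟩

/-! ### Increments of radicals across zeros -/

section Increments

variable {d : ℕ} {a b : ℝ} {D : ℕ → ℝ → ℂ}

theorem abs_rpow_sub_rpow_le_of_ne_zero (hd : 2 ≤ d) (hD : IsDerivFamily d (Ioo a b) D)
    {x y : ℝ} (hx : a < x) (hxy : x ≤ y) (hy : y < b) (h0 : ∀ t ∈ Icc x y, D 0 t ≠ 0) :
    |‖D 0 x‖ ^ ((1 : ℝ) / d) - ‖D 0 y‖ ^ ((1 : ℝ) / d)| ≤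
      ∫ t in x..y, radSpeed d (D 0 t) (D 1 t) / d := by
  obtain ⟨a', b', ha, hx', hy', hb, lam, hl, hlD⟩ := exists_root_near_Icc hd hD hx hxy hy h0
  have hsub : Ioo a' b' ⊆ Ioo a b := Ioo_subset_Ioo ha hb
  have := dist_root_le_of_ne_zero hd (hD.mono le_rfl hsub) hl hlD hx' hxy hy' h0
  rw [← norm_eq_rpow_of_pow_eq hd (hlD x ⟨hx', hxy.trans_lt hy'⟩),
    ← norm_eq_rpow_of_pow_eq hd (hlD y ⟨hx'.trans_le hxy, hy'⟩)]
  exact (abs_norm_sub_norm_le _ _).trans (by rwa [← dist_eq_norm])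

/-- If there is a zero on an interval then the moduli of the radicals at the two ends are
controlled by the integral of the speed. -/
theorem rpow_add_rpow_le_of_zero (hd : 2 ≤ d) (hD : IsDerivFamily d (Ioo a b) D)
    (hφ : IntegrableOn (fun t => radSpeed d (D 0 t) (D 1 t) / d) (Ioo a b))
    {x z y : ℝ} (hx : a < x) (hxz : x ≤ z) (hzy : z ≤ y) (hy : y < b) (hz : D 0 z = 0) :
    ‖D 0 x‖ ^ ((1 : ℝ) / d) + ‖D 0 y‖ ^ ((1 : ℝ) / d) ≤
      ∫ t in x..y, radSpeed d (D 0 t) (D 1 t) / d := by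
  have hd0 : (0 : ℝ) < (1 : ℝ) / d := by
    have : (0 : ℝ) < d := by exact_mod_cast (by omega : 0 < d)
    positivity
  have hxy := hxz.trans hzy
  have hsub : Icc x y ⊆ Ioo a b := fun t ht => ⟨hx.trans_le ht.1, ht.2.trans_lt hy⟩
  set φ := fun t => radSpeed d (D 0 t) (D 1 t) / d with hφd
  have hφ0 : ∀ t, 0 ≤ φ t := fun t => div_nonneg (radSpeed_nonneg _ _ _) (by positivity)
  set f : ℝ → ℝ := fun t => ‖D 0 t‖ ^ ((1 : ℝ) / d) with hf
  set G : ℝ → ℝ := fun t => ∫ v in x..t, φ v with hG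
  have hi : ∀ s ∈ Icc x y, ∀ t ∈ Icc x y, IntervalIntegrable φ volume s t := fun s hs t ht =>
    intervalIntegrable_of_integrableOn_Ioo hφ (Ioo_subset_Icc_self (hsub hs))
      (Ioo_subset_Icc_self (hsub ht))
  have hX : x ∈ Icc x y := left_mem_Icc.2 hxy
  have hGsub : ∀ s ∈ Icc x y, ∀ t ∈ Icc x y, G t - G s = ∫ v in s..t, φ v := fun s hs t ht =>
    intervalIntegral.integral_interval_sub_left (hi x hX t ht) (hi x hX s hs)
  have hGm : MonotoneOn G (Icc x y) := by
    intro s hs t ht hst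
    have := hGsub s hs t ht
    have := intervalIntegral.integral_nonneg_of_forall (μ := volume) hst hφ0
    linarith
  have hfc : ContinuousOn f (Icc x y) := fun t ht =>
    ((hD 0 (by omega) t (hsub ht)).continuousAt.norm.rpow_const
      (Or.inr hd0.le)).continuousWithinAt
  have hfz : ∀ t, f t = 0 ↔ D 0 t = 0 := fun t => by
    rw [hf]; simp only
    rw [Real.rpow_eq_zero (norm_nonneg _) hd0.ne', norm_eq_zero]
  have key : ∀ s t, x ≤ s → s ≤ t → t ≤ y → (∀ v ∈ Icc s t, f v ≠ 0) →
      |f s - f t| ≤ G t - G s := by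
    intro s t hs hst ht hv
    rw [hGsub s ⟨hs, hst.trans ht⟩ t ⟨hs.trans hst, ht⟩]
    exact abs_rpow_sub_rpow_le_of_ne_zero hd hD (hx.trans_le hs) hst (ht.trans_lt hy)
      fun v hv' => (hfz v).not.1 (hv v hv')
  have hfn : ∀ t, ‖f t‖ = f t := fun t => Real.norm_of_nonneg (by positivity)
  have h1 := norm_le_of_zero_right hxz (hfc.mono (Icc_subset_Icc_right hzy))
    (hGm.mono (Icc_subset_Icc_right hzy)) (fun s t hs hst ht hv => by
      rw [hfn, hfn]
      linarith [le_abs_self (f s - f t), key s t hs hst (ht.trans hzy) hv]) ((hfz z).2 hz)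
  have h2 := norm_le_of_zero_left hzy (hfc.mono (Icc_subset_Icc_left hxz))
    (hGm.mono (Icc_subset_Icc_left hxz)) (fun s t hs hst ht hv => by
      rw [hfn, hfn]
      linarith [neg_abs_le (f s - f t), key s t (hxz.trans hs) hst ht hv]) ((hfz z).2 hz)
  rw [hfn] at h1 h2
  rw [← hGsub x hX y (right_mem_Icc.2 hxy)]
  change f x + f y ≤ _
  linarith

/-- On an interval without zeros this is integration of the derivative. If there is a zero, `‖lam x
- lam y‖ ≤ ‖lam x‖ + ‖lam y‖` suffices, because the integral already controls this sum. -/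
theorem incrementBound_root (hd : 2 ≤ d) (hD : IsDerivFamily d (Ioo a b) D)
    (hφ : IntegrableOn (fun t => radSpeed d (D 0 t) (D 1 t) / d) (Ioo a b)) {lam : ℝ → ℂ}
    (hl : ContinuousOn lam (Ioo a b)) (hlD : ∀ x ∈ Ioo a b, lam x ^ d = D 0 x) :
    IncrementBound a b (fun t => radSpeed d (D 0 t) (D 1 t) / d) lam := by
  intro x y hx hxy hy
  by_cases h0 : ∀ t ∈ Icc x y, D 0 t ≠ 0
  · exact dist_root_le_of_ne_zero hd hD hl hlD hx hxy hy h0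
  · push Not at h0
    obtain ⟨z, hz, hz0⟩ := h0
    refine le_trans ?_ (rpow_add_rpow_le_of_zero hd hD hφ hx hz.1 hz.2 hy hz0)
    rw [← norm_eq_rpow_of_pow_eq hd (hlD x ⟨hx, hxy.trans_lt hy⟩),
      ← norm_eq_rpow_of_pow_eq hd (hlD y ⟨hx.trans_le hxy, hy⟩), dist_eq_norm]
    exact norm_sub_le _ _

/-- A continuous radical is almost everywhere differentiable, with the expected derivative. -/
theorem ae_hasDerivAt_root (hd : 2 ≤ d) (hD : IsDerivFamily d (Ioo a b) D)
    (hc : ContinuousOn (D d) (Ioo a b)) {lam : ℝ → ℂ}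
    (hl : ContinuousOn lam (Ioo a b)) (hlD : ∀ x ∈ Ioo a b, lam x ^ d = D 0 x) :
    ∀ᵐ x, x ∈ Ioo a b → HasDerivAt lam (lam x * (D 1 x / D 0 x) / d) x := by
  filter_upwards [hD.ae_flat] with x hx hxI
  have hn := isOpen_Ioo.mem_nhds hxI
  by_cases h0 : D 0 x = 0
  · rw [h0, div_zero, mul_zero, zero_div]
    exact hasDerivAt_root_of_flat hd isOpen_Ioo hD hc hlD hxI (hx hxI h0)
  · exact hasDerivAt_root hd (hl.continuousAt hn)
      (by filter_upwards [hn] with s hs using hlD s hs) (hD 0 (by omega) x hxI) h0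

end Increments

section

/-! ### The metric on unordered tuples -/

variable {d : ℕ}

theorem delta_eq_dist (z w : Fin d → ℂ) :
    delta z w = dist (WithLp.toLp 2 z) (WithLp.toLp 2 w) / Real.sqrt d := by
  rw [delta, EuclideanSpace.dist_eq]
  simp [dist_eq_norm]

theorem delta_nonneg (z w : Fin d → ℂ) : 0 ≤ delta z w := by
  unfold delta; positivity

theorem delta_triangle (z w v : Fin d → ℂ) : delta z v ≤ delta z w + delta w v := by
  rw [delta_eq_dist, delta_eq_dist, delta_eq_dist, ← add_div]
  gcongr
  exact dist_triangle _ _ _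

theorem delta_comm (z w : Fin d → ℂ) : delta z w = delta w z := by
  rw [delta_eq_dist, delta_eq_dist, dist_comm]

theorem delta_comp_perm (z w : Fin d → ℂ) (σ : Equiv.Perm (Fin d)) :
    delta (z ∘ σ) (w ∘ σ) = delta z w := by
  unfold delta
  congr 2
  exact Equiv.sum_comp σ (fun i => ‖z i - w i‖ ^ 2)

theorem exists_tuple_eq (a : Sym ℂ d) : ∃ z : Fin d → ℂ, tuple z = a := by
  obtain ⟨m, hm⟩ := a
  induction m using Quotient.inductionOn with
  | _ l =>
    have hl : l.length = d := hm
    subst hl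
    refine ⟨l.get, Subtype.ext ?_⟩
    change Finset.univ.val.map l.get = (l : Multiset ℂ)
    rw [Fin.univ_val_map, List.ofFn_get]

theorem symDist_tuple_le (z w : Fin d → ℂ) (σ : Equiv.Perm (Fin d)) :
    symDist (tuple z) (tuple w) ≤ delta z (w ∘ σ) := by
  rw [symDist_tuple]
  exact ciInf_le (Set.finite_range _).bddBelow σ

theorem exists_symDist_eq (z w : Fin d → ℂ) :
    ∃ σ : Equiv.Perm (Fin d), symDist (tuple z) (tuple w) = delta z (w ∘ σ) := by
  obtain ⟨σ, hσ⟩ := exists_eq_ciInf_of_finite (f := fun σ : Equiv.Perm (Fin d) => delta z (w ∘ σ))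
  exact ⟨σ, by rw [symDist_tuple, hσ]⟩

theorem symDist_nonneg (a b : Sym ℂ d) : 0 ≤ symDist a b := by
  obtain ⟨z, rfl⟩ := exists_tuple_eq a
  obtain ⟨w, rfl⟩ := exists_tuple_eq b
  obtain ⟨σ, hσ⟩ := exists_symDist_eq z w
  rw [hσ]; exact delta_nonneg _ _

theorem symDist_comm (a b : Sym ℂ d) : symDist a b = symDist b a := by
  unfold symDist
  congr 1
  ext t
  constructor <;> rintro ⟨z, w, hz, hw, rfl⟩ <;> exact ⟨w, z, hw, hz, delta_comm _ _⟩

theorem symDist_triangle (a b c : Sym ℂ d) : symDist a c ≤ symDist a b + symDist b c := by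
  obtain ⟨z, rfl⟩ := exists_tuple_eq a
  obtain ⟨w, rfl⟩ := exists_tuple_eq b
  obtain ⟨v, rfl⟩ := exists_tuple_eq c
  obtain ⟨σ, hσ⟩ := exists_symDist_eq z w
  obtain ⟨τ, hτ⟩ := exists_symDist_eq w v
  rw [hσ, hτ, ← delta_comp_perm w (v ∘ τ) σ]
  exact (symDist_tuple_le z v (σ.trans τ)).trans (delta_triangle z (w ∘ σ) _)

theorem abs_symDist_sub_le (a b c : Sym ℂ d) : |symDist a c - symDist b c| ≤ symDist a b := by
  rw [abs_le]
  have h1 := symDist_triangle a b c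
  have h2 := symDist_triangle b a c
  rw [symDist_comm b a] at h2
  constructor <;> linarith

/-! ### Tuples of radicals -/

theorem coe_radTuple (d : ℕ) (θ a : ℂ) :
    (radTuple d θ a : Multiset ℂ) = (Multiset.range d).map (θ ^ · * a) := by
  change Finset.univ.val.map (fun i : Fin d => θ ^ (i : ℕ) * a) = _
  rw [Fin.univ_val_map, List.ofFn_eq_map, Multiset.range, Multiset.map_coe,
    ← List.map_coe_finRange_eq_range, List.map_map]
  rfl

theorem coe_radTuple_eq_roots {θ a y : ℂ} (hθ : IsPrimitiveRoot θ d) (h : a ^ d = y) :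
    (radTuple d θ a : Multiset ℂ) = (Polynomial.X ^ d - Polynomial.C y).roots := by
  rw [coe_radTuple]
  exact (hθ.nthRoots_eq h).symm

theorem radTuple_eq_radTuple {θ a b : ℂ} (hθ : IsPrimitiveRoot θ d) (h : a ^ d = b ^ d) :
    radTuple d θ a = radTuple d θ b :=
  Subtype.ext ((coe_radTuple_eq_roots hθ rfl).trans
    (by rw [h]; exact (coe_radTuple_eq_roots hθ rfl).symm))

theorem pow_eq_of_radTuple (hd : 2 ≤ d) {θ a y : ℂ}
    (h : (radTuple d θ a : Multiset ℂ) = (Polynomial.X ^ d - Polynomial.C y).roots) :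
    a ^ d = y := by
  have ha : a ∈ (radTuple d θ a : Multiset ℂ) := by
    rw [coe_radTuple, Multiset.mem_map]
    exact ⟨0, by simp; omega, by simp⟩
  rw [h] at ha
  exact (Polynomial.mem_nthRoots (by omega)).1 ha

/-- The identity matching pairs `θ^i a` with `θ^i b`; all `d` differences have the same modulus, and
the normalization by `√d` cancels their number. -/
theorem symDist_radTuple_le (hd : 2 ≤ d) {θ : ℂ} (hθ : IsPrimitiveRoot θ d) (a b : ℂ) :
    symDist (radTuple d θ a) (radTuple d θ b) ≤ ‖a - b‖ := by
  have hn : ‖θ‖ = 1 := hθ.norm'_eq_one (by omega)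
  have hd0 : (0 : ℝ) < d := by exact_mod_cast (by omega : 0 < d)
  refine (symDist_tuple_le _ _ (Equiv.refl _)).trans (le_of_eq ?_)
  have : ∀ i : Fin d, ‖θ ^ (i : ℕ) * a - θ ^ (i : ℕ) * b‖ ^ 2 = ‖a - b‖ ^ 2 := fun i => by
    rw [← mul_sub, norm_mul, norm_pow, hn, one_pow, one_mul]
  simp only [delta, Function.comp, Equiv.refl_apply, this]
  rw [Finset.sum_const, Finset.card_univ, Fintype.card_fin, nsmul_eq_mul,
    Real.sqrt_mul hd0.le, Real.sqrt_sq (norm_nonneg _), mul_div_cancel_left₀]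
  exact (Real.sqrt_pos.2 hd0).ne'

theorem symDist_radTuple_le_of_pow_eq_one (hd : 2 ≤ d) {θ ζ : ℂ} (hθ : IsPrimitiveRoot θ d)
    (hζ : ζ ^ d = 1) (a b : ℂ) :
    symDist (radTuple d θ a) (radTuple d θ b) ≤ ‖a - ζ * b‖ := by
  rw [radTuple_eq_radTuple hθ (a := b) (b := ζ * b) (by rw [mul_pow, hζ, one_mul])]
  exact symDist_radTuple_le hd hθ a _

/-- The distance of two tuples of radicals is attained by a cyclic shift. -/
theorem exists_norm_sub_eq_symDist (hd : 2 ≤ d) {θ : ℂ} (hθ : IsPrimitiveRoot θ d) (a b : ℂ) :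
    ∃ r < d, ‖a - θ ^ r * b‖ = symDist (radTuple d θ a) (radTuple d θ b) := by
  have hn : ‖θ‖ = 1 := hθ.norm'_eq_one (by omega)
  have hd0 : (0 : ℝ) < d := by exact_mod_cast (by omega : 0 < d)
  obtain ⟨r, hr, hmin⟩ := Finset.exists_min_image (Finset.range d) (fun r => ‖a - θ ^ r * b‖)
    ⟨0, by simp; omega⟩
  refine ⟨r, Finset.mem_range.1 hr, le_antisymm ?_ ?_⟩
  · obtain ⟨σ, hσ⟩ := exists_symDist_eq (fun i : Fin d => θ ^ (i : ℕ) * a)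
      (fun i : Fin d => θ ^ (i : ℕ) * b)
    change _ ≤ symDist (tuple _) (tuple _)
    rw [hσ, delta, le_div_iff₀ (Real.sqrt_pos.2 hd0)]
    refine Real.le_sqrt_of_sq_le ?_
    rw [mul_pow, Real.sq_sqrt hd0.le]
    -- For any matching `σ`, the `i`-th difference is a rotation of `a - θ^(σ i - i) b`, so its
    -- modulus is at least the minimum over cyclic shifts. The exponent is written `d - i + σ i`
    -- modulo `d` to stay in `ℕ`.
    have key : ∀ i : Fin d, ‖a - θ ^ r * b‖ ^ 2 ≤
        ‖θ ^ (i : ℕ) * a - ((fun i : Fin d => θ ^ (i : ℕ) * b) ∘ σ) i‖ ^ 2 := by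
      intro i
      refine pow_le_pow_left₀ (norm_nonneg _) ?_ 2
      have h1 := hmin ((d - i + σ i) % d) (Finset.mem_range.2 (Nat.mod_lt _ (by omega)))
      have h2 : θ ^ ((d - i + σ i) % d) = θ ^ (d - (i : ℕ) + σ i) := by
        conv_rhs => rw [← Nat.mod_add_div (d - (i : ℕ) + σ i) d]
        rw [pow_add, pow_mul, hθ.pow_eq_one, one_pow, mul_one]
      have h3 : θ ^ (i : ℕ) * a - ((fun i : Fin d => θ ^ (i : ℕ) * b) ∘ σ) i =
          θ ^ (i : ℕ) * (a - θ ^ ((d - i + σ i) % d) * b) := by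
        rw [h2, mul_sub, ← mul_assoc, ← pow_add,
          show (i : ℕ) + (d - i + σ i) = d + σ i by have := i.2; omega, pow_add, hθ.pow_eq_one,
          one_mul]
        rfl
      rw [h3, norm_mul, norm_pow, hn, one_pow, one_mul]
      exact h1
    calc ‖a - θ ^ r * b‖ ^ 2 * d = ∑ _i : Fin d, ‖a - θ ^ r * b‖ ^ 2 := by
          simp [mul_comm]
      _ ≤ _ := Finset.sum_le_sum fun i _ => key i
  · refine symDist_radTuple_le_of_pow_eq_one hd hθ ?_ a b
    rw [← pow_mul, mul_comm, pow_mul, hθ.pow_eq_one, one_pow]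

/-- Factor `a^d - b^d = ∏ (a - ζ b)` over the `d`-th roots of unity; each factor is at least the
distance. Hence the solution tuple is Hölder of exponent `1/d` in the right-hand side. -/
theorem symDist_radTuple_pow_le (hd : 2 ≤ d) {θ : ℂ} (hθ : IsPrimitiveRoot θ d) (a b : ℂ) :
    symDist (radTuple d θ a) (radTuple d θ b) ^ d ≤ ‖a ^ d - b ^ d‖ := by
  have h := Finset.prod_le_prod (s := Polynomial.nthRootsFinset d (1 : ℂ))
    (fun _ _ => symDist_nonneg (radTuple d θ a) (radTuple d θ b))
    (fun ζ hζ => symDist_radTuple_le_of_pow_eq_one hd hθ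
      ((Polynomial.mem_nthRootsFinset (by omega) 1).1 hζ) a b)
  rw [Finset.prod_const, hθ.card_nthRootsFinset, ← norm_prod] at h
  rwa [hθ.pow_sub_pow_eq_prod_sub_mul a b (by omega)]

theorem symDist_radTuple_le_rpow (hd : 2 ≤ d) {θ : ℂ} (hθ : IsPrimitiveRoot θ d) {a b y z : ℂ}
    (ha : a ^ d = y) (hb : b ^ d = z) :
    symDist (radTuple d θ a) (radTuple d θ b) ≤ ‖y - z‖ ^ ((1 : ℝ) / d) := by
  have h := symDist_radTuple_pow_le hd hθ a b
  rw [ha, hb] at h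
  have h2 := Real.rpow_le_rpow (z := (1 : ℝ) / d) (pow_nonneg (symDist_nonneg _ _) _) h
    (by positivity)
  rwa [one_div, Real.pow_rpow_inv_natCast (symDist_nonneg _ _) (by omega), ← one_div] at h2

/-- A converse estimate: taking `d`-th powers is locally Lipschitz from tuples of radicals to `ℂ`.
It transfers first-order approximation of the tuple to the equation. -/
theorem norm_pow_sub_pow_le_symDist_mul (hd : 2 ≤ d) {θ : ℂ} (hθ : IsPrimitiveRoot θ d)
    (a b : ℂ) : ‖a ^ d - b ^ d‖ ≤
      symDist (radTuple d θ a) (radTuple d θ b) * (d * (‖a‖ + ‖b‖) ^ (d - 1)) := by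
  obtain ⟨r, hr, hrs⟩ := exists_norm_sub_eq_symDist hd hθ a b
  have hn : ‖θ‖ = 1 := hθ.norm'_eq_one (by omega)
  have hb : (θ ^ r * b) ^ d = b ^ d := by
    rw [mul_pow, ← pow_mul, mul_comm r, pow_mul, hθ.pow_eq_one, one_pow, one_mul]
  rw [← hrs, ← hb, ← geom_sum₂_mul, norm_mul, mul_comm]
  refine mul_le_mul_of_nonneg_left ?_ (norm_nonneg _)
  have hnb : ‖θ ^ r * b‖ = ‖b‖ := by rw [norm_mul, norm_pow, hn, one_pow, one_mul]
  have key : ∀ i ∈ Finset.range d, ‖a ^ i * (θ ^ r * b) ^ (d - 1 - i)‖ ≤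
      (‖a‖ + ‖b‖) ^ (d - 1) := by
    intro i hi
    have hi := Finset.mem_range.1 hi
    rw [norm_mul, norm_pow, norm_pow, hnb]
    calc ‖a‖ ^ i * ‖b‖ ^ (d - 1 - i) ≤ (‖a‖ + ‖b‖) ^ i * (‖a‖ + ‖b‖) ^ (d - 1 - i) := by
          gcongr <;> linarith [norm_nonneg a, norm_nonneg b]
      _ = _ := by rw [← pow_add]; congr 1; omega
  refine (norm_sum_le_of_le _ key).trans (le_of_eq ?_)
  simp

/-! ### Solution curves -/

theorem IsSolutionCurve.eq_radTuple {I : Set ℝ} {g : ℝ → ℂ} {Λ : ℝ → Sym ℂ d}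
    (h : IsSolutionCurve I g Λ) {x : ℝ} (hx : x ∈ I) {θ a : ℂ} (hθ : IsPrimitiveRoot θ d)
    (ha : a ^ d = g x) : Λ x = radTuple d θ a :=
  Subtype.ext ((h x hx).trans (coe_radTuple_eq_roots hθ ha).symm)

theorem IsSolutionCurve.pow_eq (hd : 2 ≤ d) {I : Set ℝ} {g : ℝ → ℂ} {Λ : ℝ → Sym ℂ d}
    (h : IsSolutionCurve I g Λ) {x : ℝ} (hx : x ∈ I) {θ a : ℂ} (ha : Λ x = radTuple d θ a) :
    a ^ d = g x :=
  pow_eq_of_radTuple hd (by rw [← ha]; exact h x hx)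

theorem exists_isPrimitiveRoot (hd : 2 ≤ d) : ∃ θ : ℂ, IsPrimitiveRoot θ d :=
  ⟨_, Complex.isPrimitiveRoot_exp d (by omega)⟩

theorem IsSolutionCurve.exists_eq_radTuple (hd : 2 ≤ d) {I : Set ℝ} {g : ℝ → ℂ} {Λ : ℝ → Sym ℂ d}
    (h : IsSolutionCurve I g Λ) {x : ℝ} (hx : x ∈ I) {θ : ℂ} (hθ : IsPrimitiveRoot θ d) :
    ∃ a, a ^ d = g x ∧ Λ x = radTuple d θ a := by
  obtain ⟨a, ha⟩ := IsAlgClosed.exists_pow_nat_eq (g x) (n := d) (by omega)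
  exact ⟨a, ha, h.eq_radTuple hx hθ ha⟩

theorem IsSolutionCurve.symDist_le_rpow (hd : 2 ≤ d) {I : Set ℝ} {g h : ℝ → ℂ}
    {Λ Μ : ℝ → Sym ℂ d} (hΛ : IsSolutionCurve I g Λ) (hΜ : IsSolutionCurve I h Μ) {x y : ℝ}
    (hx : x ∈ I) (hy : y ∈ I) : symDist (Λ x) (Μ y) ≤ ‖g x - h y‖ ^ ((1 : ℝ) / d) := by
  obtain ⟨θ, hθ⟩ := exists_isPrimitiveRoot hd
  obtain ⟨a, ha, ha'⟩ := hΛ.exists_eq_radTuple hd hx hθ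
  obtain ⟨b, hb, hb'⟩ := hΜ.exists_eq_radTuple hd hy hθ
  rw [ha', hb']
  exact symDist_radTuple_le_rpow hd hθ ha hb

/-- The derivative of a solution curve along a branch is determined by the equation. -/
theorem HasRadDerivAt.eq (hd : 2 ≤ d) {I : Set ℝ} (hI : IsOpen I) {g : ℝ → ℂ} {Λ : ℝ → Sym ℂ d}
    (hΛ : IsSolutionCurve I g Λ) {x : ℝ} (hx : x ∈ I) {g' : ℂ} (hg : HasDerivAt g g' x)
    {θ a L : ℂ} (hθ : IsPrimitiveRoot θ d) (h : HasRadDerivAt Λ θ a L x) :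
    L = a * (g' / g x) / d := by
  obtain ⟨h1, h2, h3⟩ := h
  have ha : a ^ d = g x := hΛ.pow_eq hd hx h1
  have hd0 : (d : ℂ) ≠ 0 := by exact_mod_cast (by omega : d ≠ 0)
  by_cases h0 : g x = 0
  · have ha0 : a = 0 := by
      rw [h0] at ha
      exact (pow_eq_zero_iff (by omega)).1 ha
    -- At a zero all branches coincide, so compatibility forces `L = θ L`, hence `L = 0`; the
    -- right-hand side is also `0`, since `a = 0`.
    have := h3 ⟨0, by omega⟩ ⟨1, by omega⟩ (by simp [ha0])
    simp only [pow_zero, one_mul, pow_one] at this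
    have hθ1 : θ - 1 ≠ 0 := sub_ne_zero.2 (hθ.ne_one (by omega))
    have hL : (θ - 1) * L = 0 := by rw [sub_mul, one_mul, ← this, sub_self]
    rw [(mul_eq_zero.1 hL).resolve_left hθ1, ha0]
    simp
  have ha0 : a ≠ 0 := fun h => h0 (by rw [← ha, h, zero_pow (by omega)])
  have hline : HasDerivAt (fun t : ℝ => a + L * ((t - x : ℝ) : ℂ)) L x := by
    have : HasDerivAt (fun t : ℝ => ((t - x : ℝ) : ℂ)) 1 x := by
      simpa using ((hasDerivAt_id x).sub_const x).ofReal_comp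
    simpa using (this.const_mul L).const_add a
  have hpow : HasDerivAt (fun t : ℝ => (a + L * ((t - x : ℝ) : ℂ)) ^ d) (d * a ^ (d - 1) * L) x := by
    have := hline.pow d
    simp only [sub_self, Complex.ofReal_zero, mul_zero, add_zero] at this
    exact this
  -- The `d`-th power of the linear branch approximates `g` up to a multiple of the tuple distance,
  -- that is, to first order. Comparing derivatives at `x` gives `g' = d a^(d-1) L`.
  have hO : (fun t : ℝ => g t - (a + L * ((t - x : ℝ) : ℂ)) ^ d) =O[𝓝 x]
      (fun t => symDist (Λ t) (tuple fun i : Fin d =>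
        θ ^ (i : ℕ) * a + θ ^ (i : ℕ) * L * ((t - x : ℝ) : ℂ))) := by
    set C : ℝ := (‖g x‖ + 1) ^ ((1 : ℝ) / d) + (‖a‖ + 1) with hC
    have e1 : ∀ᶠ t in 𝓝 x, ‖g t‖ ≤ ‖g x‖ + 1 :=
      (hg.continuousAt.norm.eventually_lt_const (by linarith)).mono fun _ h => h.le
    have e2 : ∀ᶠ t in 𝓝 x, ‖a + L * ((t - x : ℝ) : ℂ)‖ ≤ ‖a‖ + 1 :=
      (hline.continuousAt.norm.eventually_lt_const (by simp)).mono fun _ h => h.le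
    refine Asymptotics.IsBigO.of_bound (d * C ^ (d - 1)) ?_
    filter_upwards [e1, e2, hI.mem_nhds hx] with t ht1 ht2 htI
    obtain ⟨b, hb, hb'⟩ := hΛ.exists_eq_radTuple hd htI hθ
    have et : (tuple fun i : Fin d => θ ^ (i : ℕ) * a + θ ^ (i : ℕ) * L * ((t - x : ℝ) : ℂ)) =
        radTuple d θ (a + L * ((t - x : ℝ) : ℂ)) := by
      unfold radTuple
      congr 1
      funext i
      ring
    rw [et, hb', ← hb, Real.norm_of_nonneg (symDist_nonneg _ _),
      mul_comm (d * C ^ (d - 1) : ℝ)]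
    refine (norm_pow_sub_pow_le_symDist_mul hd hθ _ _).trans ?_
    refine mul_le_mul_of_nonneg_left ?_ (symDist_nonneg _ _)
    refine mul_le_mul_of_nonneg_left ?_ (Nat.cast_nonneg d)
    refine pow_le_pow_left₀ (by positivity) (add_le_add ?_ ht2) _
    rw [norm_eq_rpow_of_pow_eq hd hb]
    exact Real.rpow_le_rpow (norm_nonneg _) ht1 (by positivity)
  have ho := hO.trans_isLittleO h2
  have hdiff : HasDerivAt (fun t : ℝ => g t - (a + L * ((t - x : ℝ) : ℂ)) ^ d) 0 x := by
    rw [hasDerivAt_iff_isLittleO]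
    simpa [ha] using ho
  have huniq := hdiff.unique (hg.sub hpow)
  have hg' : g' = d * a ^ (d - 1) * L := (sub_eq_zero.1 huniq.symm)
  rw [hg', ← ha, show a ^ d = a ^ (d - 1) * a by rw [← pow_succ]; congr 1; omega]
  field_simp

theorem radIndex_spec (hd : 2 ≤ d) {θ : ℂ} (hθ : IsPrimitiveRoot θ d) (a b : ℂ) :
    ‖a - θ ^ radIndex d θ a b * b‖ = symDist (radTuple d θ a) (radTuple d θ b) :=
  (Nat.sInf_mem (s := {r : ℕ | r < d ∧ ‖a - θ ^ r * b‖ =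
    symDist (radTuple d θ a) (radTuple d θ b)}) (exists_norm_sub_eq_symDist hd hθ a b)).2

end

/-! ### Convergence in `L^q` -/

/-- Truncation at height `R`: above it, `t^q = t^{q-p} t^p` and `t^{q-p} ≤ R^{q-p}`. -/
theorem rpow_le_min_rpow_add {q p R t : ℝ} (hqp : q < p) (hR : 0 < R) (ht : 0 ≤ t) :
    t ^ q ≤ (min t R) ^ q + R ^ (q - p) * t ^ p := by
  rcases le_or_gt t R with h | h
  · rw [min_eq_left h]
    have := Real.rpow_nonneg ht p
    have := Real.rpow_nonneg hR.le (q - p)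
    nlinarith
  · have ht0 : 0 < t := hR.trans h
    have h1 : t ^ q = t ^ (q - p) * t ^ p := by
      rw [← Real.rpow_add ht0]; congr 1; ring
    have h2 : t ^ (q - p) ≤ R ^ (q - p) :=
      Real.rpow_le_rpow_of_nonpos hR h.le (by linarith)
    have h3 : 0 ≤ (min t R) ^ q := Real.rpow_nonneg (le_min ht hR.le) q
    have h4 := mul_le_mul_of_nonneg_right h2 (Real.rpow_nonneg ht p)
    linarith

/-- Almost everywhere convergence and boundedness in `L^p` imply convergence in `L^q` for
`q < p`, on a finite measure space. -/
theorem tendsto_lintegral_rpow_zero {X : Type*} [MeasurableSpace X] {μ : Measure X}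
    [IsFiniteMeasure μ] {q p : ℝ} (hq : 0 < q) (hqp : q < p) {f : ℕ → X → ℝ}
    (hf0 : ∀ n x, 0 ≤ f n x) (hf : ∀ n, AEMeasurable (f n) μ)
    (hlim : ∀ᵐ x ∂μ, Tendsto (fun n => f n x) atTop (𝓝 0)) {C : ℝ}
    (hC : ∀ᶠ n in atTop, ∫⁻ x, ENNReal.ofReal (f n x ^ p) ∂μ ≤ ENNReal.ofReal C) :
    Tendsto (fun n => ∫⁻ x, ENNReal.ofReal (f n x ^ q) ∂μ) atTop (𝓝 0) := by
  have h1 : ∀ R : ℝ, 0 < R →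
      Tendsto (fun n => ∫⁻ x, ENNReal.ofReal ((min (f n x) R) ^ q) ∂μ) atTop (𝓝 0) := by
    intro R hR
    have := tendsto_lintegral_of_dominated_convergence' (μ := μ)
      (F := fun n x => ENNReal.ofReal ((min (f n x) R) ^ q)) (f := fun _ => 0)
      (fun _ => ENNReal.ofReal (R ^ q))
      (fun n => (((hf n).min aemeasurable_const).pow_const q).ennreal_ofReal)
      (fun n => ae_of_all _ fun x => ENNReal.ofReal_le_ofReal
        (Real.rpow_le_rpow (le_min (hf0 n x) hR.le) (min_le_right _ _) hq.le))
      (by rw [lintegral_const]; exact ENNReal.mul_ne_top ENNReal.ofReal_ne_top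
            (measure_ne_top _ _))
      (by
        filter_upwards [hlim] with x hx
        have h := (hx.min (tendsto_const_nhds (x := R))).rpow_const (p := q) (Or.inr hq.le)
        rw [min_eq_left hR.le, Real.zero_rpow hq.ne'] at h
        simpa using ENNReal.tendsto_ofReal h)
    simpa using this
  rw [ENNReal.tendsto_nhds_zero]
  intro ε hε
  -- Since `q - p < 0`, a large `R` makes the tail small uniformly in `n`; the truncated part is
  -- then handled by dominated convergence.
  have hR : ∃ R : ℝ, 0 < R ∧ ENNReal.ofReal (R ^ (q - p)) * ENNReal.ofReal C ≤ ε / 2 := by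
    have h : Tendsto (fun R : ℝ => R ^ (-(p - q))) atTop (𝓝 0) :=
      tendsto_rpow_neg_atTop (by linarith)
    have h' := ENNReal.Tendsto.mul_const (ENNReal.tendsto_ofReal h)
      (Or.inr (ENNReal.ofReal_ne_top (r := C)))
    rw [ENNReal.ofReal_zero, zero_mul] at h'
    obtain ⟨R, hR1, hR2⟩ := ((ENNReal.tendsto_nhds_zero.1 h' (ε / 2)
      (ENNReal.half_pos hε.ne')).and (eventually_gt_atTop 0)).exists
    exact ⟨R, hR2, by rwa [neg_sub] at hR1⟩
  obtain ⟨R, hR0, hR⟩ := hR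
  filter_upwards [ENNReal.tendsto_nhds_zero.1 (h1 R hR0) (ε / 2) (ENNReal.half_pos hε.ne'), hC]
    with n hn hCn
  calc ∫⁻ x, ENNReal.ofReal (f n x ^ q) ∂μ
      ≤ ∫⁻ x, (ENNReal.ofReal ((min (f n x) R) ^ q) +
          ENNReal.ofReal (R ^ (q - p)) * ENNReal.ofReal (f n x ^ p)) ∂μ := by
        refine lintegral_mono fun x => ?_
        have := Real.rpow_nonneg (hf0 n x) p
        have := Real.rpow_nonneg hR0.le (q - p)
        have h3 : 0 ≤ (min (f n x) R) ^ q := Real.rpow_nonneg (le_min (hf0 n x) hR0.le) q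
        rw [← ENNReal.ofReal_mul (by positivity), ← ENNReal.ofReal_add h3 (by positivity)]
        exact ENNReal.ofReal_le_ofReal (rpow_le_min_rpow_add hqp hR0 (hf0 n x))
    _ = ∫⁻ x, ENNReal.ofReal ((min (f n x) R) ^ q) ∂μ +
          ENNReal.ofReal (R ^ (q - p)) * ∫⁻ x, ENNReal.ofReal (f n x ^ p) ∂μ := by
        rw [lintegral_add_left' (((hf n).min aemeasurable_const).pow_const q).ennreal_ofReal,
          lintegral_const_mul' _ _ ENNReal.ofReal_ne_top]
    _ ≤ ε / 2 + ε / 2 := by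
        gcongr
        exact (mul_le_mul_right hCn _).trans hR
    _ = ε := ENNReal.add_halves ε

/-! ### The set of flat points -/

/-- A bound linear in the length passes from the dyadic subintervals of generation `N` to the whole
interval with the same constant. -/
theorem setLIntegral_Ioo_le_of_dyadic {F : ℝ → ℝ≥0∞} {c : ℝ} (hc : 0 ≤ c) (N : ℕ) :
    ∀ a b : ℝ, a < b →
      (∀ a' b', a ≤ a' → a' < b' → b' ≤ b → b' - a' = (b - a) / 2 ^ N →
        ∫⁻ x in Ioo a' b', F x ≤ ENNReal.ofReal (c * (b' - a'))) →
      ∫⁻ x in Ioo a b, F x ≤ ENNReal.ofReal (c * (b - a)) := by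
  induction N with
  | zero => exact fun a b hab h => h a b le_rfl hab le_rfl (by simp)
  | succ N ih =>
    intro a b hab h
    have e : (b - a) / 2 / 2 ^ N = (b - a) / 2 ^ (N + 1) := by
      rw [pow_succ]; field_simp
    have h1 := ih a ((a + b) / 2) (by linarith) fun a' b' ha hab' hb hl =>
      h a' b' ha hab' (by linarith) (by rw [hl, ← e]; congr 1; ring)
    have h2 := ih ((a + b) / 2) b (by linarith) fun a' b' ha hab' hb hl =>
      h a' b' (by linarith) hab' hb (by rw [hl, ← e]; congr 1; ring)
    refine (setLIntegral_Ioo_le_add (c := (a + b) / 2) _).trans ((add_le_add h1 h2).trans ?_)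
    rw [← ENNReal.ofReal_add (mul_nonneg hc (by linarith)) (mul_nonneg hc (by linarith))]
    exact ENNReal.ofReal_le_ofReal (by linarith)

def flatSet (d : ℕ) (D : ℕ → ℝ → ℂ) : Set ℝ := {x | ∀ k ≤ d, D k x = 0}

/-- Uniform convergence on `(a, b)` of the derivatives of order at most `d`. -/
def TendstoCk (d : ℕ) (a b : ℝ) (E : ℕ → ℕ → ℝ → ℂ) (D : ℕ → ℝ → ℂ) : Prop :=
  ∀ ε > 0, ∀ᶠ n in atTop, ∀ k ≤ d, ∀ x ∈ Ioo a b, ‖E n k x - D k x‖ ≤ ε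

/-- On a short interval containing a flat point, uniform continuity gives `‖D d‖ ≤ ε` and the zeros
propagate this down to all lower orders with the right powers of the length. For large `n` the
family `E n` obeys the same bounds with `2 * ε`, so the scaled main estimate gives `O(ε^{q/d})`
times the length. -/
theorem tendsto_lintegral_flatSet {d : ℕ} {q : ℝ} (hd : 2 ≤ d) (hq1 : 1 ≤ q)
    (hq : q * (1 - 1 / d) < 1) {a b : ℝ} (hab : a < b) {D : ℕ → ℝ → ℂ} {E : ℕ → ℕ → ℝ → ℂ}
    (hD : IsDerivFamily d (Ioo a b) D) (hE : ∀ n, IsDerivFamily d (Ioo a b) (E n))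
    (hu : UniformContinuousOn (D d) (Ioo a b)) (hc : TendstoCk d a b E D) :
    Tendsto (fun n => ∫⁻ x in Ioo a b, (flatSet d D).indicator
      (fun x => ENNReal.ofReal (radSpeed d (E n 0 x) (E n 1 x) ^ q)) x) atTop (𝓝 0) := by
  have hC := radConstC_nonneg hq
  have hl : 0 < b - a := by linarith
  have key : ∀ ε : ℝ, 0 < ε → ∀ᶠ n in atTop, ∫⁻ x in Ioo a b, (flatSet d D).indicator
      (fun x => ENNReal.ofReal (radSpeed d (E n 0 x) (E n 1 x) ^ q)) x ≤
        ENNReal.ofReal (((2 * ε) ^ ((1 : ℝ) / d)) ^ q * radConstC d q * (b - a)) := by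
    intro ε hε
    obtain ⟨δ, hδ, hδ'⟩ := Metric.uniformContinuousOn_iff_le.1 hu ε hε
    obtain ⟨N, hN⟩ : ∃ N : ℕ, (b - a) / 2 ^ N ≤ δ := by
      obtain ⟨N, hN⟩ := exists_pow_lt_of_lt_one (div_pos hδ hl) (one_half_lt_one (α := ℝ))
      refine ⟨N, ?_⟩
      rw [one_div, inv_pow, lt_div_iff₀ hl] at hN
      rw [div_eq_inv_mul]
      exact hN.le
    set l := (b - a) / 2 ^ N with hldef
    have hl0 : 0 < l := by positivity
    -- `l` is already fixed, so closeness `η` can be chosen below `ε * (4 * l) ^ (d - k)` for each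
    -- of the orders `k = d, 0, 1` that the main estimate uses.
    set η := ε * min 1 (min ((4 * l) ^ d) ((4 * l) ^ (d - 1))) with hη
    have hη0 : 0 < η := by positivity
    filter_upwards [hc η hη0] with n hn
    refine setLIntegral_Ioo_le_of_dyadic (by positivity) N a b hab fun a' b' ha hab' hb hlen => ?_
    have hsub : Ioo a' b' ⊆ Ioo a b := Ioo_subset_Ioo ha hb
    rw [← hldef] at hlen
    by_cases hf : ∃ c ∈ Ioo a' b', c ∈ flatSet d D
    · obtain ⟨c, hcI, hcf⟩ := hf
      have hDd : ∀ x ∈ Ioo a' b', ‖D d x‖ ≤ ε := by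
        intro x hx
        have := hδ' x (hsub hx) c (hsub hcI) (by
          rw [Real.dist_eq, abs_le]
          constructor <;> linarith [hx.1, hx.2, hcI.1, hcI.2])
        rwa [hcf d le_rfl, dist_zero_right] at this
      have hDk : ∀ k ≤ d, ∀ x ∈ Ioo a' b', ‖D k x‖ ≤ ε * (4 * l) ^ (d - k) := by
        intro k hk x hx
        have := (hD.mono le_rfl hsub).norm_le_of_zeros (m := 0) hab' hε.le hDd
          (fun j _ hj => ⟨c, hcI, hcf j hj.le⟩) (Nat.zero_le k) hk x hx
        rw [hlen] at this
        refine this.trans (mul_le_mul_of_nonneg_left ?_ hε.le)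
        exact pow_le_pow_left₀ hl0.le (by linarith) _
      have hEk : ∀ k ≤ d, η ≤ ε * (4 * l) ^ (d - k) → ∀ x ∈ Ioo a' b',
          ‖E n k x‖ ≤ 2 * ε * (4 * l) ^ (d - k) := by
        intro k hk hηk x hx
        have h1 := hn k hk x (hsub hx)
        have h2 := hDk k hk x hx
        have h3 := norm_le_norm_add_norm_sub (D k x) (E n k x)
        rw [norm_sub_rev] at h3
        linarith
      have hm := lintegral_radSpeed_le hd hq1 hq (A := 2 * ε) (by positivity) hab'
        ((hE n).mono le_rfl hsub)
        (fun x hx => by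
          have := hEk d le_rfl (by
            rw [Nat.sub_self, pow_zero]
            exact mul_le_mul_of_nonneg_left (min_le_left _ _) hε.le) x hx
          simpa using this)
        (fun x hx => by
          rw [hlen]
          exact hEk 0 (by omega) (mul_le_mul_of_nonneg_left
            ((min_le_right _ _).trans (min_le_left _ _)) hε.le) x hx)
        (fun x hx => by
          rw [hlen]
          exact hEk 1 (by omega) (mul_le_mul_of_nonneg_left
            ((min_le_right _ _).trans (min_le_right _ _)) hε.le) x hx)
      refine (lintegral_mono fun x => indicator_le_self _ _ x).trans (hm.trans (le_of_eq ?_))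
      rw [mul_assoc]
    · push Not at hf
      rw [setLIntegral_congr_fun (g := fun _ => 0) measurableSet_Ioo fun x hx =>
        indicator_of_notMem (hf x hx) _]
      simp
  have hq0 : 0 < q := by linarith
  have hd0 : (0 : ℝ) < (1 : ℝ) / d := by
    have : (0 : ℝ) < d := by exact_mod_cast (by omega : 0 < d)
    positivity
  have hlim : Tendsto (fun ε : ℝ =>
      ENNReal.ofReal (((2 * ε) ^ ((1 : ℝ) / d)) ^ q * radConstC d q * (b - a))) (𝓝[>] 0) (𝓝 0) := by
    have hcont : Continuous (fun ε : ℝ =>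
      ENNReal.ofReal (((2 * ε) ^ ((1 : ℝ) / d)) ^ q * radConstC d q * (b - a))) := by
      refine ENNReal.continuous_ofReal.comp ?_
      refine (Continuous.mul ?_ continuous_const).mul continuous_const
      exact ((continuous_const.mul continuous_id).rpow_const fun _ => Or.inr hd0.le).rpow_const
        fun _ => Or.inr hq0.le
    have := (hcont.tendsto 0).mono_left (nhdsWithin_le_nhds (s := Ioi 0))
    rwa [mul_zero, Real.zero_rpow hd0.ne', Real.zero_rpow hq0.ne', zero_mul, zero_mul,
      ENNReal.ofReal_zero] at this
  rw [ENNReal.tendsto_nhds_zero]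
  intro e he
  obtain ⟨ε, h1, h2⟩ := ((ENNReal.tendsto_nhds_zero.1 hlim e he).and
    self_mem_nhdsWithin).exists
  exact (key ε h2).mono fun n hn => hn.trans h1

/-! ### Uniform bounds -/

/-- A uniform bound for the speed of the radicals, in terms of a bound for the derivatives. -/
theorem exists_lintegral_radSpeed_le {d : ℕ} {q : ℝ} (hd : 2 ≤ d) (hq1 : 1 ≤ q)
    (hq : q * (1 - 1 / d) < 1) {a b : ℝ} (hab : a < b) (K : ℝ) :
    ∃ C : ℝ, 0 ≤ C ∧ ∀ D : ℕ → ℝ → ℂ, IsDerivFamily d (Ioo a b) D →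
      (∀ k ≤ d, ∀ x ∈ Ioo a b, ‖D k x‖ ≤ K) →
      ∫⁻ x in Ioo a b, ENNReal.ofReal (radSpeed d (D 0 x) (D 1 x) ^ q) ≤ ENNReal.ofReal C := by
  have hC := radConstC_nonneg hq
  have hl : 0 < b - a := by linarith
  set m := min 1 (min ((4 * (b - a)) ^ d) ((4 * (b - a)) ^ (d - 1))) with hm
  have hm0 : 0 < m := by positivity
  -- Dividing by `m` makes the single bound `K` imply the three scaled hypotheses of the main
  -- estimate.
  set A := (|K| + 1) / m with hA
  have hA0 : 0 < A := by positivity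
  have hK : K ≤ A * m := by
    rw [hA, div_mul_cancel₀ _ hm0.ne']
    linarith [le_abs_self K]
  refine ⟨(A ^ ((1 : ℝ) / d)) ^ q * (radConstC d q * (b - a)), by positivity, fun D hD hb => ?_⟩
  refine lintegral_radSpeed_le hd hq1 hq hA0 hab hD (fun x hx => (hb d le_rfl x hx).trans ?_)
    (fun x hx => (hb 0 (by omega) x hx).trans ?_) (fun x hx => (hb 1 (by omega) x hx).trans ?_)
  · exact hK.trans (mul_le_of_le_one_right hA0.le (min_le_left _ _))
  · exact hK.trans (mul_le_mul_of_nonneg_left ((min_le_right _ _).trans (min_le_left _ _)) hA0.le)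
  · exact hK.trans (mul_le_mul_of_nonneg_left ((min_le_right _ _).trans (min_le_right _ _)) hA0.le)

/-! ### Comparison of the derivatives of two radicals -/

/-- This comes from splitting `a y'/y - ζ b z'/z` as `(a - ζ b) y'/y + ζ b (y'/y - z'/z)`, for roots
`a`, `b` of `y`, `z` and a root of unity `ζ` with `a` and `ζ b` close. -/
def radDiff (d : ℕ) (y y' z z' : ℂ) : ℝ :=
  (‖y - z‖ ^ ((1 : ℝ) / d) * ‖y' / y‖ + ‖z‖ ^ ((1 : ℝ) / d) * ‖y' / y - z' / z‖) / d

/-- A bound for the distance of the derivatives of corresponding `d`-th roots of two functions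
with values `y`, `z` and derivatives `y'`, `z'`. -/
def radDiffMin (d : ℕ) (y y' z z' : ℂ) : ℝ :=
  min (radDiff d y y' z z') (radSpeed d y y' / d + radSpeed d z z' / d)

theorem radDiffMin_nonneg (d : ℕ) (y y' z z' : ℂ) : 0 ≤ radDiffMin d y y' z z' := by
  have := radSpeed_nonneg d y y'
  have := radSpeed_nonneg d z z'
  refine le_min ?_ (by positivity)
  unfold radDiff
  positivity

/-- Both bounds are needed: `radDiff` tends to `0` as `(z, z')` approaches `(y, y')` with `y ≠ 0`,
while the sum of the speeds is what the integral estimate controls. -/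
theorem norm_root_deriv_sub_le {d : ℕ} (hd : 2 ≤ d) {a b y y' z z' ζ : ℂ} (ha : a ^ d = y)
    (hb : b ^ d = z) (hζ : ζ ^ d = 1) (hab : ‖a - ζ * b‖ ≤ ‖y - z‖ ^ ((1 : ℝ) / d)) :
    ‖a * (y' / y) / d - ζ * (b * (z' / z) / d)‖ ≤ radDiffMin d y y' z z' := by
  have hn : ‖ζ‖ = 1 := by
    have h : ‖ζ‖ ^ d = 1 := by rw [← norm_pow, hζ, norm_one]
    exact (pow_eq_one_iff_of_nonneg (norm_nonneg _) (by omega)).1 h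
  refine le_min ?_ ?_
  · have e : a * (y' / y) / d - ζ * (b * (z' / z) / d) =
        ((a - ζ * b) * (y' / y) + ζ * b * (y' / y - z' / z)) / d := by ring
    rw [e, norm_div, Complex.norm_natCast, radDiff]
    gcongr
    refine (norm_add_le _ _).trans ?_
    rw [norm_mul, norm_mul, norm_mul, hn, one_mul, norm_eq_rpow_of_pow_eq hd hb]
    gcongr
  · refine (norm_sub_le _ _).trans ?_
    rw [norm_mul, hn, one_mul, norm_root_deriv hd ha, norm_root_deriv hd hb]

theorem exists_norm_sub_le_rpow {d : ℕ} (hd : 2 ≤ d) {a b y z : ℂ} (ha : a ^ d = y)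
    (hb : b ^ d = z) : ∃ ζ : ℂ, ζ ^ d = 1 ∧ ‖a - ζ * b‖ ≤ ‖y - z‖ ^ ((1 : ℝ) / d) := by
  obtain ⟨θ, hθ⟩ := exists_isPrimitiveRoot hd
  obtain ⟨r, -, hr⟩ := exists_norm_sub_eq_symDist hd hθ a b
  refine ⟨θ ^ r, ?_, ?_⟩
  · rw [← pow_mul, mul_comm, pow_mul, hθ.pow_eq_one, one_pow]
  · rw [hr]; exact symDist_radTuple_le_rpow hd hθ ha hb

/-- The speeds divided by `d` are the moduli of the derivatives of any roots, so roots may be chosen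
and matched at this one point; no continuous selection is involved. -/
theorem abs_radSpeed_sub_le {d : ℕ} (hd : 2 ≤ d) (y y' z z' : ℂ) :
    |radSpeed d y y' / d - radSpeed d z z' / d| ≤ radDiffMin d y y' z z' := by
  obtain ⟨a, ha⟩ := IsAlgClosed.exists_pow_nat_eq y (n := d) (by omega)
  obtain ⟨b, hb⟩ := IsAlgClosed.exists_pow_nat_eq z (n := d) (by omega)
  obtain ⟨ζ, hζ, hab⟩ := exists_norm_sub_le_rpow hd ha hb
  refine le_trans ?_ (norm_root_deriv_sub_le (y' := y') (z' := z') hd ha hb hζ hab)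
  have hn : ‖ζ‖ = 1 := by
    have h : ‖ζ‖ ^ d = 1 := by rw [← norm_pow, hζ, norm_one]
    exact (pow_eq_one_iff_of_nonneg (norm_nonneg _) (by omega)).1 h
  have h := abs_norm_sub_norm_le (a * (y' / y) / d) (ζ * (b * (z' / z) / d))
  rwa [norm_mul, hn, one_mul, norm_root_deriv hd ha, norm_root_deriv hd hb] at h

theorem radDiffMin_le_of_eq_zero {d : ℕ} (hd : 2 ≤ d) {y : ℂ} (hy : y = 0) (y' z z' : ℂ) :
    radDiffMin d y y' z z' ≤ radSpeed d z z' := by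
  have hd1 : (1 : ℝ) ≤ d := by exact_mod_cast (by omega : 1 ≤ d)
  refine (min_le_right _ _).trans ?_
  rw [hy, radSpeed_zero_left hd, zero_div, zero_add]
  exact div_le_self (radSpeed_nonneg _ _ _) hd1

/-! ### Convergence of the speeds -/

/-- `D` is a bounded family of derivatives, the last of which is uniformly continuous. -/
structure RegularFamily (d : ℕ) (a b : ℝ) (D : ℕ → ℝ → ℂ) : Prop where
  isDerivFamily : IsDerivFamily d (Ioo a b) D
  bounded : ∃ K : ℝ, ∀ k ≤ d, ∀ x ∈ Ioo a b, ‖D k x‖ ≤ K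
  uniformContinuousOn : UniformContinuousOn (D d) (Ioo a b)

/-- The strict inequality leaves room for an exponent `p > q` with the same uniform bounds, as
required to pass from pointwise to `L^q` convergence. -/
theorem exists_larger_exponent {d : ℕ} {q : ℝ} (hd : 2 ≤ d) (hq : q * (1 - 1 / d) < 1) :
    ∃ p, q < p ∧ p * (1 - 1 / d) < 1 := by
  have he : (0 : ℝ) < 1 - 1 / d := by linarith [one_div_sub_one_neg hd]
  have h : q < 1 / (1 - 1 / (d : ℝ)) := by rwa [lt_div_iff₀ he]
  obtain ⟨p, h1, h2⟩ := exists_between h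
  exact ⟨p, h1, by rwa [lt_div_iff₀ he] at h2⟩

theorem IsDerivFamily.aemeasurable {d : ℕ} {J : Set ℝ} (hJ : MeasurableSet J) {D : ℕ → ℝ → ℂ}
    (hD : IsDerivFamily d J D) {k : ℕ} (hk : k < d) : AEMeasurable (D k) (volume.restrict J) :=
  ContinuousOn.aemeasurable (fun x hx => (hD k hk x hx).continuousAt.continuousWithinAt) hJ

theorem IsDerivFamily.aemeasurable_radDiffMin {d : ℕ} (hd : 2 ≤ d) {J : Set ℝ}
    (hJ : MeasurableSet J) {D E : ℕ → ℝ → ℂ} (hD : IsDerivFamily d J D)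
    (hE : IsDerivFamily d J E) :
    AEMeasurable (fun x => radDiffMin d (D 0 x) (D 1 x) (E 0 x) (E 1 x))
      (volume.restrict J) := by
  have h0 := hD.aemeasurable hJ (k := 0) (by omega)
  have h1 := hD.aemeasurable hJ (k := 1) (by omega)
  have e0 := hE.aemeasurable hJ (k := 0) (by omega)
  have e1 := hE.aemeasurable hJ (k := 1) (by omega)
  have hh := h1.div h0
  have he := e1.div e0
  refine AEMeasurable.min ?_ (((hD.aemeasurable_radSpeed hJ hd).div_const _).add
    ((hE.aemeasurable_radSpeed hJ hd).div_const _))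
  exact ((((h0.sub e0).norm.pow_const _).mul hh.norm).add
    ((e0.norm.pow_const _).mul (hh.sub he).norm)).div_const _

theorem TendstoCk.tendsto {d : ℕ} {a b : ℝ} {E : ℕ → ℕ → ℝ → ℂ} {D : ℕ → ℝ → ℂ}
    (h : TendstoCk d a b E D) {k : ℕ} (hk : k ≤ d) {x : ℝ} (hx : x ∈ Ioo a b) :
    Tendsto (fun n => E n k x) atTop (𝓝 (D k x)) := by
  rw [Metric.tendsto_atTop']
  intro ε hε
  obtain ⟨N, hN⟩ := eventually_atTop.1 (h (ε / 2) (by positivity))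
  refine ⟨N, fun n hn => ?_⟩
  rw [dist_eq_norm]
  linarith [hN n hn.le k hk x hx]

theorem tendsto_radDiffMin {d : ℕ} (hd : 2 ≤ d) {y y' : ℂ} (hy : y ≠ 0) {z z' : ℕ → ℂ}
    (hz : Tendsto z atTop (𝓝 y)) (hz' : Tendsto z' atTop (𝓝 y')) :
    Tendsto (fun n => radDiffMin d y y' (z n) (z' n)) atTop (𝓝 0) := by
  have hd0 : (0 : ℝ) < (1 : ℝ) / d := by
    have : (0 : ℝ) < d := by exact_mod_cast (by omega : 0 < d)
    positivity
  have h1 : Tendsto (fun n => radDiff d y y' (z n) (z' n)) atTop (𝓝 0) := by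
    have a1 := ((tendsto_const_nhds (x := y)).sub hz).norm.rpow_const
      (p := (1 : ℝ) / d) (Or.inr hd0.le)
    have a2 := hz.norm.rpow_const (p := (1 : ℝ) / d) (Or.inr hd0.le)
    have a3 := ((tendsto_const_nhds (x := y' / y)).sub (hz'.div hz hy)).norm
    have := ((a1.mul_const ‖y' / y‖).add (a2.mul a3)).div_const (d : ℝ)
    simpa [Real.zero_rpow hd0.ne', radDiff, Real.zero_rpow (one_div (d : ℝ) ▸ hd0.ne')] using this
  exact squeeze_zero (fun n => radDiffMin_nonneg _ _ _ _ _) (fun n => min_le_left _ _) h1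

theorem tendsto_lintegral_radDiffMin {d : ℕ} {q : ℝ} (hd : 2 ≤ d) (hq1 : 1 ≤ q)
    (hq : q * (1 - 1 / d) < 1) {a b : ℝ} (hab : a < b) {D : ℕ → ℝ → ℂ} {E : ℕ → ℕ → ℝ → ℂ}
    (hD : RegularFamily d a b D) (hE : ∀ n, RegularFamily d a b (E n))
    (hc : TendstoCk d a b E D) :
    Tendsto (fun n => ∫⁻ x in Ioo a b, ENNReal.ofReal
      (radDiffMin d (D 0 x) (D 1 x) (E n 0 x) (E n 1 x) ^ q)) atTop (𝓝 0) := by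
  obtain ⟨p, hqp, hp⟩ := exists_larger_exponent hd hq
  have hp1 : 1 ≤ p := hq1.trans hqp.le
  have hd1 : (1 : ℝ) ≤ d := by exact_mod_cast (by omega : 1 ≤ d)
  obtain ⟨K, hK⟩ := hD.bounded
  obtain ⟨C, hC0, hC⟩ := exists_lintegral_radSpeed_le hd hp1 hp hab (K + 1)
  have hDC := hC D hD.isDerivFamily fun k hk x hx => (hK k hk x hx).trans (by linarith)
  -- Only the part off the zeros of `D 0` converges pointwise for free; the zeros are almost all in
  -- `flatSet d D` and are treated separately.
  set f : ℕ → ℝ → ℝ := fun n => {x | D 0 x ≠ 0}.indicator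
    (fun x => radDiffMin d (D 0 x) (D 1 x) (E n 0 x) (E n 1 x)) with hf
  have hf0 : ∀ n x, 0 ≤ f n x := fun n x =>
    indicator_nonneg (fun _ _ => radDiffMin_nonneg _ _ _ _ _) x
  have hfle : ∀ n x, f n x ≤ radSpeed d (D 0 x) (D 1 x) + radSpeed d (E n 0 x) (E n 1 x) := by
    intro n x
    have h1 := radSpeed_nonneg d (D 0 x) (D 1 x)
    have h2 := radSpeed_nonneg d (E n 0 x) (E n 1 x)
    have h3 : f n x ≤ radDiffMin d (D 0 x) (D 1 x) (E n 0 x) (E n 1 x) := by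
      rw [hf]
      exact Set.indicator_le_self' (fun _ _ => radDiffMin_nonneg _ _ _ _ _) x
    refine h3.trans ?_
    exact (min_le_right _ _).trans (add_le_add (div_le_self h1 hd1) (div_le_self h2 hd1))
  have hmeas : ∀ n, AEMeasurable (f n) (volume.restrict (Ioo a b)) := fun n =>
    (hD.isDerivFamily.aemeasurable_radDiffMin hd measurableSet_Ioo (hE n).isDerivFamily).indicator₀
      ((hD.isDerivFamily.aemeasurable measurableSet_Ioo (k := 0) (by omega)).nullMeasurableSet_preimage
        (measurableSet_singleton (0 : ℂ)).compl)
  have hlim : ∀ᵐ x ∂(volume.restrict (Ioo a b)), Tendsto (fun n => f n x) atTop (𝓝 0) := by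
    refine (ae_restrict_iff' measurableSet_Ioo).2 (ae_of_all _ fun x hx => ?_)
    by_cases h0 : D 0 x = 0
    · simp [hf, h0]
    · have := tendsto_radDiffMin hd h0 (hc.tendsto (k := 0) (by omega) hx)
        (hc.tendsto (k := 1) (by omega) hx)
      refine this.congr fun n => ?_
      have hx0 : x ∈ {x | D 0 x ≠ 0} := h0
      simp only [hf, indicator_of_mem hx0]
  have hbd : ∀ᶠ n in atTop, ∫⁻ x in Ioo a b, ENNReal.ofReal (f n x ^ p) ≤
      ENNReal.ofReal (2 ^ p * (C + C)) := by
    filter_upwards [hc 1 one_pos] with n hn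
    have hEC := hC (E n) (hE n).isDerivFamily fun k hk x hx => by
      have h1 := norm_le_norm_add_norm_sub (D k x) (E n k x)
      rw [norm_sub_rev] at h1
      linarith [hn k hk x hx, hK k hk x hx]
    calc ∫⁻ x in Ioo a b, ENNReal.ofReal (f n x ^ p)
        ≤ ∫⁻ x in Ioo a b, ENNReal.ofReal (2 ^ p) *
          (ENNReal.ofReal (radSpeed d (D 0 x) (D 1 x) ^ p) +
            ENNReal.ofReal (radSpeed d (E n 0 x) (E n 1 x) ^ p)) := by
          refine lintegral_mono fun x => ?_
          have h1 := radSpeed_nonneg d (D 0 x) (D 1 x)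
          have h2 := radSpeed_nonneg d (E n 0 x) (E n 1 x)
          rw [← ENNReal.ofReal_add (by positivity) (by positivity),
            ← ENNReal.ofReal_mul (by positivity)]
          refine ENNReal.ofReal_le_ofReal ?_
          exact (Real.rpow_le_rpow (hf0 n x) (hfle n x) (by linarith)).trans
            (add_rpow_le_two_rpow_mul h1 h2 (by linarith))
      _ ≤ ENNReal.ofReal (2 ^ p) * (ENNReal.ofReal C + ENNReal.ofReal C) := by
          rw [lintegral_const_mul' _ _ ENNReal.ofReal_ne_top, lintegral_add_left'
            ((hD.isDerivFamily.aemeasurable_radSpeed measurableSet_Ioo hd).pow_const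
              p).ennreal_ofReal]
          gcongr
      _ = _ := by
          rw [← ENNReal.ofReal_add hC0 hC0, ← ENNReal.ofReal_mul (by positivity)]
  have h1 := tendsto_lintegral_rpow_zero (by linarith) hqp hf0 hmeas hlim hbd
  have h2 := tendsto_lintegral_flatSet hd hq1 hq hab hD.isDerivFamily
    (fun n => (hE n).isDerivFamily) hD.uniformContinuousOn hc
  have h3 := h1.add h2
  rw [add_zero] at h3
  refine tendsto_of_tendsto_of_tendsto_of_le_of_le tendsto_const_nhds h3 (fun n => zero_le)
    fun n => ?_
  simp only
  rw [← lintegral_add_left' ((hmeas n).pow_const q).ennreal_ofReal]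
  refine lintegral_mono_ae ?_
  filter_upwards [ae_restrict_mem measurableSet_Ioo,
    ae_restrict_of_ae hD.isDerivFamily.ae_flat] with x hx hflat
  by_cases h0 : D 0 x = 0
  · refine le_trans ?_ le_add_self
    rw [indicator_of_mem (show x ∈ flatSet d D from hflat hx h0)]
    exact ENNReal.ofReal_le_ofReal (Real.rpow_le_rpow (radDiffMin_nonneg _ _ _ _ _)
      (radDiffMin_le_of_eq_zero hd h0 _ _ _) (by linarith))
  · refine le_trans (le_of_eq ?_) le_self_add
    have hx0 : x ∈ {x | D 0 x ≠ 0} := h0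
    simp only [hf, indicator_of_mem hx0]

section

/-! ### Membership in Sobolev spaces -/

theorem eLpNorm_eq_lintegral_ofReal {X : Type*} [MeasurableSpace X] {μ : Measure X} {q : ℝ}
    (hq : 0 < q) {f : X → ℝ} (hf : ∀ x, 0 ≤ f x) :
    eLpNorm f (ENNReal.ofReal q) μ = (∫⁻ x, ENNReal.ofReal (f x ^ q) ∂μ) ^ (1 / q) := by
  rw [eLpNorm_eq_lintegral_rpow_enorm_toReal (by simpa using hq) ENNReal.ofReal_ne_top,
    ENNReal.toReal_ofReal hq.le]
  congr 1
  refine lintegral_congr fun x => ?_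
  rw [Real.enorm_of_nonneg (hf x), ENNReal.ofReal_rpow_of_nonneg (hf x) hq.le]

variable {d : ℕ} {a b q : ℝ}

theorem RegularFamily.memLp_radSpeed (hd : 2 ≤ d) (hq1 : 1 ≤ q) (hq : q * (1 - 1 / d) < 1)
    (hab : a < b) {D : ℕ → ℝ → ℂ} (hD : RegularFamily d a b D) :
    MemLp (fun x => radSpeed d (D 0 x) (D 1 x) / d) (ENNReal.ofReal q)
      (volume.restrict (Ioo a b)) := by
  have hq0 : 0 < q := by linarith
  have hm := hD.isDerivFamily.aemeasurable_radSpeed (e := d) measurableSet_Ioo hd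
  have h : MemLp (fun x => radSpeed d (D 0 x) (D 1 x)) (ENNReal.ofReal q)
      (volume.restrict (Ioo a b)) := by
    refine ⟨hm.aestronglyMeasurable, ?_⟩
    rw [eLpNorm_eq_lintegral_ofReal hq0 fun x => radSpeed_nonneg _ _ _]
    obtain ⟨K, hK⟩ := hD.bounded
    obtain ⟨C, -, hC⟩ := exists_lintegral_radSpeed_le hd hq1 hq hab K
    exact ENNReal.rpow_lt_top_of_nonneg (by positivity)
      ((hC D hD.isDerivFamily hK).trans_lt ENNReal.ofReal_lt_top).ne
  simpa [div_eq_mul_inv] using h.mul_const ((d : ℝ)⁻¹)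

theorem radSpeed_div_nonneg {E : Type*} [NormedAddCommGroup E] (d : ℕ) (y y' : E) :
    0 ≤ radSpeed d y y' / d :=
  div_nonneg (radSpeed_nonneg _ _ _) (Nat.cast_nonneg _)

theorem one_le_ofReal (hq1 : 1 ≤ q) : 1 ≤ ENNReal.ofReal q := by
  rw [← ENNReal.ofReal_one]; exact ENNReal.ofReal_le_ofReal hq1

theorem RegularFamily.integrableOn_radSpeed (hd : 2 ≤ d) (hab : a < b) {D : ℕ → ℝ → ℂ}
    (hD : RegularFamily d a b D) :
    IntegrableOn (fun x => radSpeed d (D 0 x) (D 1 x) / d) (Ioo a b) := by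
  have h : (0 : ℝ) < 1 / d := by
    have : (0 : ℝ) < d := by exact_mod_cast (by omega : 0 < d)
    positivity
  exact (hD.memLp_radSpeed hd le_rfl (by linarith) hab).integrable (one_le_ofReal le_rfl)

/-- A function with controlled increments on a bounded interval is bounded. -/
theorem IncrementBound.memLp {E : Type*} [NormedAddCommGroup E] [SecondCountableTopology E]
    {φ : ℝ → ℝ} {u : ℝ → E} (hab : a < b) (h : IncrementBound a b φ u)
    (hφ : IntegrableOn φ (Ioo a b)) (hφ0 : ∀ x, 0 ≤ φ x) (p : ℝ≥0∞) :
    MemLp u p (volume.restrict (Ioo a b)) := by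
  obtain ⟨c, hc⟩ := exists_between hab
  have hI : ∀ s ∈ Ioo a b, ∀ t ∈ Ioo a b, s ≤ t → dist (u s) (u t) ≤ ∫ v in Ioo a b, φ v := by
    intro s hs t ht hst
    refine (h s t hs.1 hst ht.2).trans ?_
    rw [intervalIntegral.integral_of_le hst]
    have hst' : Ioc s t ⊆ Ioo a b := fun v hv => ⟨hs.1.trans hv.1, hv.2.trans_lt ht.2⟩
    exact setIntegral_mono_set hφ (ae_of_all _ hφ0) (LE.le.eventuallyLE hst')
  refine MemLp.of_bound ((h.continuousOn hφ).aestronglyMeasurable measurableSet_Ioo)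
    (‖u c‖ + ∫ v in Ioo a b, φ v) ((ae_restrict_iff' measurableSet_Ioo).2
      (ae_of_all _ fun x hx => ?_))
  have : dist (u x) (u c) ≤ ∫ v in Ioo a b, φ v := by
    rcases le_total x c with hxc | hxc
    · exact hI x hx c hc hxc
    · rw [dist_comm]; exact hI c hc x hx hxc
  rw [dist_eq_norm, norm_sub_rev] at this
  linarith [norm_le_norm_add_norm_sub (u c) (u x)]

/-- The distance to `T` is 1-Lipschitz, so it suffices to bound the distance of `Λ x` and `Λ y`,
which is at most that of suitable roots. The bound is the same for all `T`, as the definition of the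
Sobolev class demands. -/
theorem incrementBound_symDist (hd : 2 ≤ d) {D : ℕ → ℝ → ℂ} (hD : IsDerivFamily d (Ioo a b) D)
    (hφ : IntegrableOn (fun t => radSpeed d (D 0 t) (D 1 t) / d) (Ioo a b)) {Λ : ℝ → Sym ℂ d}
    (hΛ : IsSolutionCurve (Ioo a b) (D 0) Λ) (T : Sym ℂ d) :
    IncrementBound a b (fun t => radSpeed d (D 0 t) (D 1 t) / d) (fun x => symDist (Λ x) T) := by
  intro x y hx hxy hy
  rw [Real.dist_eq]
  refine (abs_symDist_sub_le _ _ _).trans ?_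
  obtain ⟨θ, hθ⟩ := exists_isPrimitiveRoot hd
  have hxI : x ∈ Ioo a b := ⟨hx, hxy.trans_lt hy⟩
  have hyI : y ∈ Ioo a b := ⟨hx.trans_le hxy, hy⟩
  by_cases h0 : ∀ t ∈ Icc x y, D 0 t ≠ 0
  · obtain ⟨a', b', ha, hx', hy', hb, lam, hl, hlD⟩ := exists_root_near_Icc hd hD hx hxy hy h0
    refine le_trans ?_ (dist_root_le_of_ne_zero hd (hD.mono le_rfl (Ioo_subset_Ioo ha hb)) hl hlD
      hx' hxy hy' h0)
    rw [hΛ.eq_radTuple hxI hθ (hlD x ⟨hx', hxy.trans_lt hy'⟩),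
      hΛ.eq_radTuple hyI hθ (hlD y ⟨hx'.trans_le hxy, hy'⟩), dist_eq_norm]
    exact symDist_radTuple_le hd hθ _ _
  · push Not at h0
    obtain ⟨z, hz, hz0⟩ := h0
    refine le_trans ?_ (rpow_add_rpow_le_of_zero hd hD hφ hx hz.1 hz.2 hy hz0)
    obtain ⟨r, hr, hr'⟩ := hΛ.exists_eq_radTuple hd hxI hθ
    obtain ⟨s, hs, hs'⟩ := hΛ.exists_eq_radTuple hd hyI hθ
    rw [hr', hs', ← norm_eq_rpow_of_pow_eq hd hr, ← norm_eq_rpow_of_pow_eq hd hs]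
    exact (symDist_radTuple_le hd hθ _ _).trans (norm_sub_le _ _)

theorem memRadSobolev_of_isSolutionCurve (hd : 2 ≤ d) (hq1 : 1 ≤ q)
    (hq : q * (1 - 1 / d) < 1) (hab : a < b) {D : ℕ → ℝ → ℂ} (hD : RegularFamily d a b D)
    {Λ : ℝ → Sym ℂ d} (hΛ : IsSolutionCurve (Ioo a b) (D 0) Λ) :
    MemRadSobolev (Ioo a b) (ENNReal.ofReal q) Λ := by
  have hφ := hD.integrableOn_radSpeed hd hab
  have hφ0 : ∀ x, 0 ≤ radSpeed d (D 0 x) (D 1 x) / d := fun x => radSpeed_div_nonneg _ _ _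
  have hL := hD.memLp_radSpeed hd hq1 hq hab
  refine ⟨⟨fun x => radSpeed d (D 0 x) (D 1 x) / d, hφ0, hL, fun T => ?_⟩, fun x hx => ?_⟩
  · have h := incrementBound_symDist hd hD.isDerivFamily hφ hΛ T
    have hae : ∀ᵐ x ∂(volume.restrict (Ioo a b)),
        ‖deriv (fun x => symDist (Λ x) T) x‖ ≤ radSpeed d (D 0 x) (D 1 x) / d :=
      (ae_restrict_iff' measurableSet_Ioo).2 (h.ae_norm_deriv_le hφ hφ0)
    refine ⟨h.memLp hab hφ hφ0 _, deriv (fun x => symDist (Λ x) T), ?_,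
      h.hasWeakDerivOn hab hφ hφ0, hae⟩
    refine hL.mono (measurable_deriv _).aestronglyMeasurable ?_
    filter_upwards [hae] with x hx
    exact hx.trans (le_abs_self _)
  · obtain ⟨θ, hθ⟩ := exists_isPrimitiveRoot hd
    obtain ⟨r, -, hr⟩ := hΛ.exists_eq_radTuple hd hx hθ
    exact ⟨θ, r, hθ, hr⟩

theorem ae_norm_deriv_root (hd : 2 ≤ d) {D : ℕ → ℝ → ℂ} (hD : RegularFamily d a b D)
    {lam : ℝ → ℂ} (hl : ContinuousOn lam (Ioo a b)) (hlD : ∀ x ∈ Ioo a b, lam x ^ d = D 0 x) :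
    ∀ᵐ x ∂(volume.restrict (Ioo a b)), ‖deriv lam x‖ = radSpeed d (D 0 x) (D 1 x) / d := by
  refine (ae_restrict_iff' measurableSet_Ioo).2 ?_
  filter_upwards [ae_hasDerivAt_root hd hD.isDerivFamily hD.uniformContinuousOn.continuousOn hl hlD]
    with x hx hxI
  rw [(hx hxI).deriv, norm_root_deriv hd (hlD x hxI)]

theorem memW1Classical_root (hd : 2 ≤ d) (hq1 : 1 ≤ q)
    (hq : q * (1 - 1 / d) < 1) (hab : a < b) {D : ℕ → ℝ → ℂ} (hD : RegularFamily d a b D)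
    {lam : ℝ → ℂ} (hl : ContinuousOn lam (Ioo a b)) (hlD : ∀ x ∈ Ioo a b, lam x ^ d = D 0 x) :
    MemW1Classical (Ioo a b) (ENNReal.ofReal q) lam := by
  have hφ := hD.integrableOn_radSpeed hd hab
  have hφ0 : ∀ x, 0 ≤ radSpeed d (D 0 x) (D 1 x) / d := fun x => radSpeed_div_nonneg _ _ _
  have h := incrementBound_root hd hD.isDerivFamily hφ hl hlD
  have hdiff : ∀ᵐ x, x ∈ Ioo a b → DifferentiableAt ℝ lam x := by
    filter_upwards [ae_hasDerivAt_root hd hD.isDerivFamily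
      hD.uniformContinuousOn.continuousOn hl hlD] with x hx hxI
    exact (hx hxI).differentiableAt
  refine ⟨(ae_restrict_iff' measurableSet_Ioo).2 hdiff, h.memLp hab hφ hφ0 _, ?_,
    h.hasWeakDerivOn_complex hab hφ hφ0 hdiff⟩
  refine (hD.memLp_radSpeed hd hq1 hq hab).mono (measurable_deriv _).aestronglyMeasurable ?_
  filter_upwards [ae_norm_deriv_root hd hD hl hlD] with x hx
  rw [hx]
  exact le_abs_self _

/-! ### Convergence of the radical distance and of the derivatives -/

section Convergence

variable {D : ℕ → ℝ → ℂ} {E : ℕ → ℕ → ℝ → ℂ}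

theorem tendsto_eLpNorm_radDiffMin (hd : 2 ≤ d) (hq1 : 1 ≤ q) (hq : q * (1 - 1 / d) < 1)
    (hab : a < b) (hD : RegularFamily d a b D) (hE : ∀ n, RegularFamily d a b (E n))
    (hc : TendstoCk d a b E D) :
    Tendsto (fun n => eLpNorm (fun x => radDiffMin d (D 0 x) (D 1 x) (E n 0 x) (E n 1 x))
      (ENNReal.ofReal q) (volume.restrict (Ioo a b))) atTop (𝓝 0) := by
  have hq0 : 0 < q := by linarith
  have h := (tendsto_lintegral_radDiffMin hd hq1 hq hab hD hE hc).ennrpow_const (1 / q)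
  rw [ENNReal.zero_rpow_of_pos (by positivity)] at h
  refine h.congr fun n => ?_
  rw [eLpNorm_eq_lintegral_ofReal hq0 fun x => radDiffMin_nonneg _ _ _ _ _]

/-- The equation determines the derivatives along the branches, and the shift chosen by `radIndex`
realizes the tuple distance, which is at most `‖g x - h x‖^{1/d}`. So each term of the supremum is a
matched difference of root derivatives. -/
theorem sRad1_le (hd : 2 ≤ d) {I : Set ℝ} (hI : IsOpen I) {g h : ℝ → ℂ} {Λ Μ : ℝ → Sym ℂ d}
    (hΛ : IsSolutionCurve I g Λ) (hΜ : IsSolutionCurve I h Μ) {x : ℝ} (hx : x ∈ I) {g' h' : ℂ}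
    (hg : HasDerivAt g g' x) (hh : HasDerivAt h h' x) :
    sRad1 Λ Μ x ≤ ENNReal.ofReal (radDiffMin d (g x) g' (h x) h') := by
  refine iSup_le fun θ => iSup_le fun r => iSup_le fun L => iSup_le fun s => iSup_le fun M =>
    iSup_le fun hθ => iSup_le fun hL => iSup_le fun hM => ?_
  have hr := hΛ.pow_eq hd hx hL.1
  have hs := hΜ.pow_eq hd hx hM.1
  rw [HasRadDerivAt.eq hd hI hΛ hx hg hθ hL, HasRadDerivAt.eq hd hI hΜ hx hh hθ hM,
    ← ofReal_norm]
  refine ENNReal.ofReal_le_ofReal (norm_root_deriv_sub_le hd hr hs ?_ ?_)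
  · rw [← pow_mul, mul_comm, pow_mul, hθ.pow_eq_one, one_pow]
  · rw [radIndex_spec hd hθ]
    exact symDist_radTuple_le_rpow hd hθ hr hs

theorem tendsto_radDist (hd : 2 ≤ d) (hq1 : 1 ≤ q) (hq : q * (1 - 1 / d) < 1)
    (hab : a < b) (hD : RegularFamily d a b D) (hE : ∀ n, RegularFamily d a b (E n))
    (hc : TendstoCk d a b E D) {Λ : ℝ → Sym ℂ d} {Λn : ℕ → ℝ → Sym ℂ d}
    (hΛ : IsSolutionCurve (Ioo a b) (D 0) Λ)
    (hΛn : ∀ n, IsSolutionCurve (Ioo a b) (E n 0) (Λn n)) :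
    Tendsto (fun n => radDist (ENNReal.ofReal q) (Ioo a b) Λ (Λn n)) atTop (𝓝 0) := by
  have h0 : Tendsto (fun n => eLpNorm (sRad0 Λ (Λn n)) ⊤ (volume.restrict (Ioo a b)))
      atTop (𝓝 0) := by
    rw [ENNReal.tendsto_nhds_zero]
    intro ε hε
    obtain ⟨e, he0, heε⟩ : ∃ e : ℝ, 0 < e ∧ ENNReal.ofReal e ≤ ε := by
      rcases eq_or_ne ε ⊤ with rfl | hne
      · exact ⟨1, one_pos, le_top⟩
      · exact ⟨ε.toReal, ENNReal.toReal_pos hε.ne' hne, ENNReal.ofReal_toReal_le⟩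
    -- Closeness `e ^ d` of the right-hand sides gives closeness `e` of the tuples by the Hölder
    -- exponent `1/d`.
    filter_upwards [hc (e ^ d) (by positivity)] with n hn
    rw [eLpNorm_exponent_top]
    refine le_trans (eLpNormEssSup_le_of_ae_bound (C := e) ?_) heε
    refine (ae_restrict_iff' measurableSet_Ioo).2 (ae_of_all _ fun x hx => ?_)
    rw [sRad0, Real.norm_of_nonneg (symDist_nonneg _ _)]
    refine (hΛ.symDist_le_rpow hd (hΛn n) hx hx).trans ?_
    have h1 := Real.rpow_le_rpow (z := (1 : ℝ) / d) (norm_nonneg _) (hn 0 (by omega) x hx)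
      (by positivity)
    rw [one_div, Real.pow_rpow_inv_natCast he0.le (by omega), norm_sub_rev] at h1
    rwa [one_div]
  have h1 := tendsto_eLpNorm_radDiffMin hd hq1 hq hab hD hE hc
  have h := h0.add h1
  rw [add_zero] at h
  refine tendsto_of_tendsto_of_tendsto_of_le_of_le tendsto_const_nhds h (fun n => zero_le)
    fun n => ?_
  -- Domination by the measurable `radDiffMin` is enough; measurability of `sRad1` is not required.
  refine add_le_add le_rfl (eLpNorm_mono_enorm_ae ?_)
  refine (ae_restrict_iff' measurableSet_Ioo).2 (ae_of_all _ fun x hx => ?_)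
  rw [enorm_eq_self, Real.enorm_of_nonneg (radDiffMin_nonneg _ _ _ _ _)]
  exact sRad1_le hd isOpen_Ioo hΛ (hΛn n) hx (hD.isDerivFamily 0 (by omega) x hx)
    ((hE n).isDerivFamily 0 (by omega) x hx)

theorem tendsto_eLpNorm_norm_deriv_sub (hd : 2 ≤ d) (hq1 : 1 ≤ q) (hq : q * (1 - 1 / d) < 1)
    (hab : a < b) (hD : RegularFamily d a b D) (hE : ∀ n, RegularFamily d a b (E n))
    (hc : TendstoCk d a b E D) {lam : ℝ → ℂ} {lamn : ℕ → ℝ → ℂ}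
    (hl : ContinuousOn lam (Ioo a b)) (hln : ∀ n, ContinuousOn (lamn n) (Ioo a b))
    (hlD : ∀ x ∈ Ioo a b, lam x ^ d = D 0 x) (hlE : ∀ n, ∀ x ∈ Ioo a b, lamn n x ^ d = E n 0 x) :
    Tendsto (fun n => eLpNorm (fun x => ‖deriv lam x‖ - ‖deriv (lamn n) x‖)
      (ENNReal.ofReal q) (volume.restrict (Ioo a b))) atTop (𝓝 0) := by
  refine tendsto_of_tendsto_of_tendsto_of_le_of_le tendsto_const_nhds
    (tendsto_eLpNorm_radDiffMin hd hq1 hq hab hD hE hc) (fun n => zero_le) fun n => ?_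
  refine eLpNorm_mono_ae_real ?_
  filter_upwards [ae_norm_deriv_root hd hD hl hlD, ae_norm_deriv_root hd (hE n) (hln n) (hlE n)]
    with x h1 h2
  rw [h1, h2]
  exact abs_radSpeed_sub_le hd _ _ _ _

/-- Convergence of the moduli in `L^p` implies convergence of the norms. -/
theorem tendsto_eLpNorm_of_norm_sub {X F : Type*} [MeasurableSpace X] [NormedAddCommGroup F]
    {μ : Measure X} {p : ℝ≥0∞} (hp : 1 ≤ p) {f : X → F} {fn : ℕ → X → F} (hf : MemLp f p μ)
    (hfn : ∀ n, AEStronglyMeasurable (fn n) μ)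
    (h : Tendsto (fun n => eLpNorm (fun x => ‖f x‖ - ‖fn n x‖) p μ) atTop (𝓝 0)) :
    Tendsto (fun n => eLpNorm (fn n) p μ) atTop (𝓝 (eLpNorm f p μ)) := by
  have hm : ∀ n, AEStronglyMeasurable (fun x => ‖f x‖ - ‖fn n x‖) μ := fun n =>
    hf.1.norm.sub (hfn n).norm
  have h1 : ∀ n, eLpNorm f p μ ≤
      eLpNorm (fn n) p μ + eLpNorm (fun x => ‖f x‖ - ‖fn n x‖) p μ := by
    intro n
    have := eLpNorm_add_le (hfn n).norm (hm n) hp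
    rw [eLpNorm_norm (fn n)] at this
    refine le_trans (le_of_eq ?_) this
    rw [← eLpNorm_norm f]
    congr 1
    funext x
    simp
  have h2 : ∀ n, eLpNorm (fn n) p μ ≤
      eLpNorm f p μ + eLpNorm (fun x => ‖f x‖ - ‖fn n x‖) p μ := by
    intro n
    have := eLpNorm_sub_le hf.1.norm (hm n) hp
    rw [eLpNorm_norm f] at this
    refine le_trans (le_of_eq ?_) this
    rw [← eLpNorm_norm (fn n)]
    congr 1
    funext x
    simp
  refine tendsto_of_tendsto_of_tendsto_of_le_of_le
    (g := fun n => eLpNorm f p μ - eLpNorm (fun x => ‖f x‖ - ‖fn n x‖) p μ)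
    (h := fun n => eLpNorm f p μ + eLpNorm (fun x => ‖f x‖ - ‖fn n x‖) p μ) ?_ ?_
    (fun n => tsub_le_iff_right.2 (h1 n)) h2
  · simpa using ENNReal.Tendsto.sub tendsto_const_nhds h (Or.inl hf.2.ne)
  · simpa using (tendsto_const_nhds (x := eLpNorm f p μ)).add h

end Convergence

/-! ### Functions of class `C^d` up to the boundary -/

/-- Continuous extensions to the compact closure make all derivatives bounded and the top one
uniformly continuous. -/
theorem regularFamily_of_memCkClosure (hab : a < b) {g : ℝ → ℂ}
    (hg : MemCkClosure d (Ioo a b) g) :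
    RegularFamily d a b (fun k => iteratedDerivWithin k g (Ioo a b)) := by
  obtain ⟨hC, hext⟩ := hg
  have hcpt : IsCompact (closure (Ioo a b)) := by
    rw [closure_Ioo hab.ne]; exact isCompact_Icc
  refine ⟨fun k hk x hx => ?_, ?_, ?_⟩
  · have hn := isOpen_Ioo.mem_nhds hx
    have h := (hC.differentiableOn_iteratedDerivWithin (m := k) (by exact_mod_cast hk)
      (uniqueDiffOn_Ioo a b)).differentiableAt hn
    rw [iteratedDerivWithin_succ, derivWithin_of_mem_nhds hn]
    exact h.hasDerivAt
  · have h : ∀ k, ∃ K : ℝ, k ≤ d → ∀ x ∈ Ioo a b, ‖iteratedDerivWithin k g (Ioo a b) x‖ ≤ K := by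
      intro k
      by_cases hk : k ≤ d
      · obtain ⟨G, hG, hGg⟩ := hext k hk
        obtain ⟨K, hK⟩ := hcpt.exists_bound_of_continuousOn hG
        exact ⟨K, fun _ x hx => by rw [← hGg hx]; exact hK x (subset_closure hx)⟩
      · exact ⟨0, fun h => absurd h hk⟩
    choose K hK using h
    refine ⟨∑ k ∈ Finset.range (d + 1), |K k|, fun k hk x hx => (hK k hk x hx).trans ?_⟩
    exact (le_abs_self _).trans (Finset.single_le_sum (f := fun k => |K k|)
      (fun _ _ => abs_nonneg _) (Finset.mem_range.2 (by omega)))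
  · obtain ⟨G, hG, hGg⟩ := hext d le_rfl
    exact ((hcpt.uniformContinuousOn_of_continuous hG).mono subset_closure).congr hGg

theorem tendstoCk_of_ckNorm {g : ℝ → ℂ} {gn : ℕ → ℝ → ℂ}
    (hg : MemCkClosure d (Ioo a b) g) (hgn : ∀ n, MemCkClosure d (Ioo a b) (gn n))
    (h : Tendsto (fun n => ckNorm d (Ioo a b) (g - gn n)) atTop (𝓝 0)) :
    TendstoCk d a b (fun n k => iteratedDerivWithin k (gn n) (Ioo a b))
      (fun k => iteratedDerivWithin k g (Ioo a b)) := by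
  intro ε hε
  filter_upwards [ENNReal.tendsto_nhds_zero.1 h (ENNReal.ofReal ε) (by simpa using hε)]
    with n hn k hk x hx
  have hle : ‖iteratedDerivWithin k (g - gn n) (Ioo a b) x‖ₑ ≤ ckNorm d (Ioo a b) (g - gn n) := by
    unfold ckNorm
    exact le_iSup₂_of_le k (Finset.mem_range.2 (by omega)) (le_iSup₂_of_le x hx le_rfl)
  rw [iteratedDerivWithin_sub hx (uniqueDiffOn_Ioo a b)
    ((hg.1.of_le (by exact_mod_cast hk)) x hx) (((hgn n).1.of_le (by exact_mod_cast hk)) x hx)] at hle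
  have := hle.trans hn
  rw [← ofReal_norm, ENNReal.ofReal_le_ofReal_iff hε.le] at this
  rwa [norm_sub_rev]

end

end RadicalCurves

end

/-! ### Convergence of solution curves and of continuous radicals -/

theorem theorem5p1 (d : ℕ) (hd : 2 ≤ d) (α β : ℝ) (hαβ : α < β)
    (g : ℝ → ℂ) (gn : ℕ → ℝ → ℂ)
    (hg : RadicalCurves.MemCkClosure d (Ioo α β) g)
    (hgn : ∀ n, RadicalCurves.MemCkClosure d (Ioo α β) (gn n))
    (hconv : Tendsto (fun n => RadicalCurves.ckNorm d (Ioo α β) (g - gn n)) atTop (𝓝 0))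
    (q : ℝ) (hq1 : 1 ≤ q) (hq : q < (d : ℝ) / ((d : ℝ) - 1)) :
    (∀ (Λ : ℝ → Sym ℂ d) (Λn : ℕ → ℝ → Sym ℂ d),
      RadicalCurves.IsSolutionCurve (Ioo α β) g Λ →
      (∀ n, RadicalCurves.IsSolutionCurve (Ioo α β) (gn n) (Λn n)) →
        RadicalCurves.MemRadSobolev (Ioo α β) (ENNReal.ofReal q) Λ ∧
        (∀ n, RadicalCurves.MemRadSobolev (Ioo α β) (ENNReal.ofReal q) (Λn n)) ∧
        Tendsto (fun n => RadicalCurves.radDist (ENNReal.ofReal q) (Ioo α β) Λ (Λn n))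
          atTop (𝓝 0)) ∧
    (∀ (lam : ℝ → ℂ) (lamn : ℕ → ℝ → ℂ),
      ContinuousOn lam (Ioo α β) → (∀ n, ContinuousOn (lamn n) (Ioo α β)) →
      (∀ x ∈ Ioo α β, lam x ^ d = g x) → (∀ n, ∀ x ∈ Ioo α β, lamn n x ^ d = gn n x) →
        RadicalCurves.MemW1Classical (Ioo α β) (ENNReal.ofReal q) lam ∧
        (∀ n, RadicalCurves.MemW1Classical (Ioo α β) (ENNReal.ofReal q) (lamn n)) ∧
        Tendsto (fun n => eLpNorm (fun x => ‖deriv lam x‖ - ‖deriv (lamn n) x‖)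
          (ENNReal.ofReal q) (volume.restrict (Ioo α β))) atTop (𝓝 0) ∧
        Tendsto (fun n => eLpNorm (deriv (lamn n)) (ENNReal.ofReal q)
          (volume.restrict (Ioo α β))) atTop
          (𝓝 (eLpNorm (deriv lam) (ENNReal.ofReal q) (volume.restrict (Ioo α β))))) := by
  have hq' := RadicalCurves.mul_one_sub_one_div_lt_one hd hq
  have hD := RadicalCurves.regularFamily_of_memCkClosure hαβ hg
  have hE := fun n => RadicalCurves.regularFamily_of_memCkClosure hαβ (hgn n)
  have hc := RadicalCurves.tendstoCk_of_ckNorm hg hgn hconv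
  have h0 : ∀ h : ℝ → ℂ, iteratedDerivWithin 0 h (Ioo α β) = h := fun h =>
    iteratedDerivWithin_zero
  refine ⟨fun Λ Λn hΛ hΛn => ?_, fun lam lamn hl hln hlg hlgn => ?_⟩
  · have hΛ' : RadicalCurves.IsSolutionCurve (Ioo α β) (iteratedDerivWithin 0 g (Ioo α β)) Λ := by
      rwa [h0]
    have hΛn' : ∀ n, RadicalCurves.IsSolutionCurve (Ioo α β)
        (iteratedDerivWithin 0 (gn n) (Ioo α β)) (Λn n) := fun n => by
      rw [h0]; exact hΛn n
    exact ⟨RadicalCurves.memRadSobolev_of_isSolutionCurve hd hq1 hq' hαβ hD hΛ',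
      fun n => RadicalCurves.memRadSobolev_of_isSolutionCurve hd hq1 hq' hαβ (hE n) (hΛn' n),
      RadicalCurves.tendsto_radDist hd hq1 hq' hαβ hD hE hc hΛ' hΛn'⟩
  · have hlg' : ∀ x ∈ Ioo α β, lam x ^ d = iteratedDerivWithin 0 g (Ioo α β) x := by
      rwa [h0]
    have hlgn' : ∀ n, ∀ x ∈ Ioo α β,
        lamn n x ^ d = iteratedDerivWithin 0 (gn n) (Ioo α β) x := fun n => by
      rw [h0]; exact hlgn n
    have hW := RadicalCurves.memW1Classical_root hd hq1 hq' hαβ hD hl hlg'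
    have hWn := fun n => RadicalCurves.memW1Classical_root hd hq1 hq' hαβ (hE n) (hln n) (hlgn' n)
    have hlim := RadicalCurves.tendsto_eLpNorm_norm_deriv_sub hd hq1 hq' hαβ hD hE hc hl hln
      hlg' hlgn'
    exact ⟨hW, hWn, hlim, RadicalCurves.tendsto_eLpNorm_of_norm_sub
      (RadicalCurves.one_le_ofReal hq1) hW.2.2.1 (fun n => (hWn n).2.2.1.1) hlim⟩
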